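/- There are absolute constants $K>0$ and $p\in\mathbb N$ such that the following holds. Let $n\ge 2$, $\sigma\ge 0$, $\delta\in(0,1]$, let $\theta_{1:n}=(\theta_1,\dots,\theta_n)\in\mathbb R^n$ belong to $\mathrm{TV}(C_n)$, that is, $\|D\theta_{1:n}\|_1=\sum_{t=2}^n|\theta_t-\theta_{t-1}|\le C_n$, and let $|\theta_1|\le U$. Let $y_t=\theta_t+Z_t$, $t=1,\dots,n$, where $Z_1,\dots,Z_n$ are independent random variables that are $\sigma$-subgaussian: $\mathbb E\,e^{sZ_t}\le e^{s^2\sigma^2/2}$ for all $s\in\mathbb R$ (so they have mean zero). Let $x_1,\dots,x_n$ be the predictions of the policy ARROWS described below, run on the observations $y_t$ with inputs $n,\sigma$ and $\beta=24+\frac{8\log(8/\delta)}{\log n}$. Then with probability at least $1-\delta$ the dynamic regret for the losses $\ell_t(x)=(x-\theta_t)^2$ satisfies $$\sum_{t=1}^n\ell_t(x_t)-\sum_{t=1}^n\inf_{x\in\mathbb R}\ell_t(x)=\sum_{t=1}^n(x_t-\theta_t)^2\le K\bigl(1+\log n+\log(1/\delta)\bigr)^p\Bigl(n^{1/3}C_n^{2/3}\sigma^{4/3}+U^2+C_n^2+\sigma^2\Bigr),$$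 i.e. it is $\tilde O(n^{1/3}C_n^{2/3}\sigma^{4/3}+U^2+C_n^2+\sigma^2)$, where $\tilde O$ hides factors that are polylogarithmic in $n$ and $1/\delta$. The policy ARROWS: put $y_0=0$ and start the first bin at $t_h=1$. In round $t=1,\dots,n$, with $t_h$ the start time of the current bin, predict $x_t=y_{t-1}$ if $t=t_h$ (a new bin), and otherwise the average $x_t=\bar y_{t_h:t-1}$ of $y_{t_h},\dots,y_{t-1}$. Then observe $y_t$, let $\tilde y$ be the vector $(y_{t_h}-\bar y_{t_h:t},\dots,y_t-\bar y_{t_h:t})$ padded by zeros at its end to length $k$, the least power of $2$ that is at least $t-t_h+1$, and let $\hat\alpha=T(H\tilde y)$, where $H$ is the $k\times k$ orthogonal discrete Haar wavelet transform and $T$ is coordinatewise soft thresholding with threshold $\sigma\sqrt{\beta\log n}$. Write $\hat\alpha[l]$, $0\le l<\log_2 k$, for the block of the $2^l$ Haar coefficients at level $l$ ($l=0$ the coarsest). If $\frac1{\sqrt k}\sum_{l=0}^{\log_2 k-1}2^{l/2}\|\hat\alpha[l]\|_1>\frac{\sigma}{\sqrt k}$, then a new bin starts at $t_h=t+1$;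 otherwise the current bin continues. -/

import Mathlib

/-! Sequences `θ 1, …, θ n` and `y 1, …, y n` are functions on `ℕ` of which only the values at
`1, …, n` are used. -/

namespace Arrows

/-- The total variation class `TV(C)`: the sequences `θ 1, …, θ n` with
`‖Dθ‖₁ = |θ 2 - θ 1| + … + |θ n - θ (n-1)| ≤ C`. -/
def TVClass (n : ℕ) (C : ℝ) : Set (ℕ → ℝ) :=
  {θ | ∑ t ∈ Finset.Ico 1 n, |θ (t + 1) - θ t| ≤ C}

/-- The quadratic loss `ℓ_t(x) = (x - θ t)²`. -/
def quadLoss (θ : ℕ → ℝ) (t : ℕ) (x : ℝ) : ℝ := (x - θ t) ^ 2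

/-- The (realized) dynamic regret `∑ₜ ℓ_t(x t) - ∑ₜ inf_z ℓ_t(z)` of the predictions
`x 1, …, x n`. -/
noncomputable def dynamicRegret (n : ℕ) (loss : ℕ → ℝ → ℝ) (x : ℕ → ℝ) : ℝ :=
  ∑ t ∈ Finset.Icc 1 n, loss t (x t) - ∑ t ∈ Finset.Icc 1 n, ⨅ z : ℝ, loss t z

/-- The average of `y a, …, y b`. -/
noncomputable def avg (y : ℕ → ℝ) (a b : ℕ) : ℝ :=
  (∑ s ∈ Finset.Icc a b, y s) / ((b + 1 - a : ℕ) : ℝ)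

/-- The exponent `J` of the padded length: `2 ^ J` is the least power of `2` that is at least the
number `b + 1 - a` of the indices `a, …, b`. -/
def padExp (a b : ℕ) : ℕ := Nat.clog 2 (b + 1 - a)

/-- `y a, …, y b`, recentred by its average, then padded by zeros at the end. -/
noncomputable def pad0 (y : ℕ → ℝ) (a b : ℕ) : Fin (2 ^ padExp a b) → ℝ :=
  fun j => if a + (j : ℕ) ≤ b then y (a + (j : ℕ)) - avg y a b else 0

/-- The orthogonal discrete Haar transform matrix of size `2 ^ J`. Row `0` is constant. Row
`2 ^ l + i` with `l < J` and `i < 2 ^ l` is the wavelet of level `l` at position `i`: it is supported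
on the `i`-th block of length `2 ^ (J - l)`, with values `(2 ^ (J - l)) ^ (-1/2)` on the first half of
this block and the opposite value on the second half. -/
noncomputable def haarMatrix (J : ℕ) : Matrix (Fin (2 ^ J)) (Fin (2 ^ J)) ℝ :=
  fun r c =>
    if (r : ℕ) = 0 then 1 / Real.sqrt (2 ^ J)
    else
      let l := Nat.log 2 (r : ℕ)
      let i := (r : ℕ) - 2 ^ l
      let B := 2 ^ (J - l)
      if (c : ℕ) / B = i then
        (if (c : ℕ) % B < B / 2 then 1 / Real.sqrt (B : ℝ) else -(1 / Real.sqrt (B : ℝ)))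
      else 0

/-- Soft thresholding with threshold `lam`. -/
noncomputable def softThreshold (lam x : ℝ) : ℝ := Real.sign x * max (|x| - lam) 0

/-- The denoised Haar coefficients `T(H pad₀(y a, …, y b))`, where `T` is coordinatewise soft
thresholding with threshold `σ √(β log n)`. -/
noncomputable def coeffs (n : ℕ) (σ β : ℝ) (y : ℕ → ℝ) (a b : ℕ) : Fin (2 ^ padExp a b) → ℝ :=
  fun r => softThreshold (σ * Real.sqrt (β * Real.log n))
    ((haarMatrix (padExp a b)).mulVec (pad0 y a b) r)

/-- The `ℓ¹` norm of the block of level `l`, which holds the coordinates `2 ^ l, …, 2 ^ (l+1) - 1`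
when coordinates are numbered from `0`. -/
noncomputable def levelNorm {J : ℕ} (α : Fin (2 ^ J) → ℝ) (l : ℕ) : ℝ :=
  ∑ r ∈ Finset.univ.filter
      (fun r : Fin (2 ^ J) => 2 ^ l ≤ (r : ℕ) ∧ (r : ℕ) < 2 ^ (l + 1)), |α r|

/-- The restart rule, evaluated at time `t` in a bin that started at time `h`. -/
def Restart (n : ℕ) (σ β : ℝ) (y : ℕ → ℝ) (h t : ℕ) : Prop :=
  σ / Real.sqrt (2 ^ padExp h t) <
    1 / Real.sqrt (2 ^ padExp h t) *
      ∑ l ∈ Finset.range (padExp h t), Real.sqrt (2 ^ l) * levelNorm (coeffs n σ β y h t) l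

open Classical in
/-- The start time `t_h` of the current bin at the beginning of round `t` (the value at `t = 0` is
not used). -/
noncomputable def binStart (n : ℕ) (σ β : ℝ) (y : ℕ → ℝ) : ℕ → ℕ
  | 0 => 1
  | 1 => 1
  | t + 2 =>
    if Restart n σ β y (binStart n σ β y (t + 1)) (t + 1) then t + 2
    else binStart n σ β y (t + 1)

/-- The prediction of ARROWS in round `t ≥ 1`. The bin is new exactly if it starts at `t`; then the
previous observation is predicted, with the convention `y₀ = 0`. Otherwise the prediction is the
average of the observations in the current bin. -/
noncomputable def predict (n : ℕ) (σ β : ℝ) (y : ℕ → ℝ) (t : ℕ) : ℝ :=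
  if binStart n σ β y t = t then (if t = 1 then 0 else y (t - 1))
  else avg y (binStart n σ β y t) (t - 1)

end Arrows

/-! All randomness is confined to one event, `GoodNoise`: every Haar coefficient of every recentred
noise segment, and every normalized interval sum of the noise, is at most `λ = σ √(β log n)`. These
are `O(n⁴)` linear functionals of norm at most one, so a Chernoff bound and a union bound suffice
(`measureReal_goodNoise`). Since all segments are covered, the data-dependent bins cause no
difficulty, and the rest is deterministic.

On this event the restart rule is informative in both directions. Let a bin have padded length `k =
2 ^ J` and variation `V`. At each level, `2 ^ (l/2)` times the `ℓ¹` norm of the true coefficients is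
at most `√k V`. Soft thresholding leaves no coefficient larger than the true one, so a restart
forces `σ ≤ J √k V` (`le_variation_of_restart`). Without a restart, the thresholded coefficients
have `ℓ²` norm at most `σ`, and the energy hidden by the threshold is at most of order `λ^(4/3) ∑
|a|^(2/3)` over the true coefficients `a`; by Hölder, the variance of `θ` in the bin is of order `σ²
+ λ^(4/3) J k^(1/3) V^(2/3)` (`sum_sq_sub_avg_le_of_not_restart`).

The bias of running averages is controlled by this variance, and their noise sums harmonically. Thus
a bin costs `σ²`, its squared variation and its rate term, up to logarithms (`sum_sq_bin_le`). Over
the bins, Hölder turns `∑ L^(1/3) V^(2/3)` into `n^(1/3) C^(2/3)`. The number of bins needs no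
separate count: the power `2/3` of the restart inequality gives `σ² ≤ σ^(4/3) J k^(1/3) V^(2/3)`, so
each bin except possibly the last pays for its own `σ²`. -/

namespace Arrows

open Finset

/-! ### Haar coefficients of sequences -/

/-- The sum of `f` over the `i`-th block of length `b`. -/
noncomputable def blockSum (f : ℕ → ℝ) (b i : ℕ) : ℝ := ∑ j ∈ range b, f (i * b + j)

/-- The Haar coefficient of `f` on the `i`-th block of length `2 * b`. -/
noncomputable def haarCoef (b : ℕ) (f : ℕ → ℝ) (i : ℕ) : ℝ :=
  (blockSum f b (2 * i) - blockSum f b (2 * i + 1)) / Real.sqrt (2 * b)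

/-- The Haar wavelet on the `i`-th block of length `2 * b`. -/
noncomputable def haarWave (b i c : ℕ) : ℝ :=
  if c / (2 * b) = i then
    (if c % (2 * b) < b then 1 / Real.sqrt (2 * b) else -(1 / Real.sqrt (2 * b)))
  else 0

theorem sum_range_mul_eq_sum_blocks (f : ℕ → ℝ) (b N : ℕ) :
    ∑ j ∈ range (N * b), f j = ∑ i ∈ range N, blockSum f b i := by
  induction N with
  | zero => simp
  | succ N ih =>
    rw [sum_range_succ, ← ih, Nat.succ_mul, sum_range_add]; rfl

theorem blockSum_two_mul (f : ℕ → ℝ) (b i : ℕ) :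
    blockSum f (2 * b) i = blockSum f b (2 * i) + blockSum f b (2 * i + 1) := by
  unfold blockSum
  rw [two_mul, sum_range_add]
  congr 1 <;> refine sum_congr rfl fun j _ => congrArg f (by ring)

theorem haarWave_of_left_half {b i j : ℕ} (hj : j < b) :
    haarWave b i (2 * i * b + j) = 1 / Real.sqrt (2 * b) := by
  have e : 2 * i * b + j = j + (2 * b) * i := by ring
  have h1 : (2 * i * b + j) / (2 * b) = i := by
    rw [e, Nat.add_mul_div_left _ _ (by omega), Nat.div_eq_of_lt (by omega), zero_add]
  have h2 : (2 * i * b + j) % (2 * b) = j := by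
    rw [e, Nat.add_mul_mod_self_left, Nat.mod_eq_of_lt (by omega)]
  simp only [haarWave, h1, h2, if_true, if_pos hj]

theorem haarWave_of_right_half {b i j : ℕ} (hj : j < b) :
    haarWave b i ((2 * i + 1) * b + j) = -(1 / Real.sqrt (2 * b)) := by
  have e : (2 * i + 1) * b + j = (b + j) + (2 * b) * i := by ring
  have h1 : ((2 * i + 1) * b + j) / (2 * b) = i := by
    rw [e, Nat.add_mul_div_left _ _ (by omega), Nat.div_eq_of_lt (by omega), zero_add]
  have h2 : ((2 * i + 1) * b + j) % (2 * b) = b + j := by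
    rw [e, Nat.add_mul_mod_self_left, Nat.mod_eq_of_lt (by omega)]
  simp only [haarWave, h1, h2, if_true, if_neg (show ¬ b + j < b by omega)]

theorem sum_haarWave_mul {b i N : ℕ} (hb : 0 < b) (hi : i < N) (f : ℕ → ℝ) :
    ∑ c ∈ range (N * (2 * b)), haarWave b i c * f c = haarCoef b f i := by
  rw [sum_range_mul_eq_sum_blocks, sum_eq_single i]
  · rw [blockSum_two_mul]
    unfold haarCoef
    rw [sub_div, sub_eq_add_neg]
    congr 1
    · unfold blockSum
      rw [sum_div]
      refine sum_congr rfl fun j hj => ?_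
      beta_reduce
      rw [haarWave_of_left_half (mem_range.1 hj)]; ring
    · unfold blockSum
      rw [sum_div, ← sum_neg_distrib]
      refine sum_congr rfl fun j hj => ?_
      beta_reduce
      rw [haarWave_of_right_half (mem_range.1 hj)]; ring
  · intro q _ hq
    refine sum_eq_zero fun j hj => ?_
    have hj := mem_range.1 hj
    have h1 : (q * (2 * b) + j) / (2 * b) = q := by
      rw [add_comm, Nat.add_mul_div_right _ _ (by omega), Nat.div_eq_of_lt (by omega), zero_add]
    simp only [haarWave, h1, if_neg hq, zero_mul]
  · intro h; exact absurd (mem_range.2 hi) h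

theorem sum_haarWave_sq {b i N : ℕ} (hb : 0 < b) (hi : i < N) :
    ∑ c ∈ range (N * (2 * b)), haarWave b i c ^ 2 = 1 := by
  have hb' : (0 : ℝ) < b := by exact_mod_cast hb
  simp_rw [sq]
  rw [sum_haarWave_mul hb hi, haarCoef]
  have h1 : blockSum (haarWave b i) b (2 * i) = b * (1 / Real.sqrt (2 * b)) := by
    unfold blockSum
    rw [sum_congr rfl fun j hj => haarWave_of_left_half (mem_range.1 hj), sum_const, card_range,
      nsmul_eq_mul]
  have h2 : blockSum (haarWave b i) b (2 * i + 1) = b * -(1 / Real.sqrt (2 * b)) := by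
    unfold blockSum
    rw [sum_congr rfl fun j hj => haarWave_of_right_half (mem_range.1 hj), sum_const, card_range,
      nsmul_eq_mul]
  have h3 := Real.sq_sqrt (show (0 : ℝ) ≤ 2 * b by positivity)
  have hp : 0 < Real.sqrt (2 * b) := by positivity
  rw [h1, h2, show (b * (1 / Real.sqrt (2 * b)) - b * -(1 / Real.sqrt (2 * b))) / Real.sqrt (2 * b)
    = 2 * b / Real.sqrt (2 * b) ^ 2 by field_simp; ring, h3, div_self (by positivity)]

theorem haarMatrix_eq_haarWave {J l i : ℕ} (hl : l < J) (hi : i < 2 ^ l)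
    {r : Fin (2 ^ J)} (hr : (r : ℕ) = 2 ^ l + i) (c : Fin (2 ^ J)) :
    haarMatrix J r c = haarWave (2 ^ (J - l - 1)) i c := by
  have h0 : (r : ℕ) ≠ 0 := by have := Nat.two_pow_pos l; omega
  have hlog : Nat.log 2 (r : ℕ) = l := by
    rw [Nat.log_eq_iff (by right; exact ⟨by norm_num, h0⟩), pow_succ]; omega
  have hB : 2 ^ (J - l) = 2 * 2 ^ (J - l - 1) := by
    rw [← pow_succ']; congr 1; omega
  have hB2 : 2 * 2 ^ (J - l - 1) / 2 = 2 ^ (J - l - 1) := by omega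
  have hi' : 2 ^ l + i - 2 ^ l = i := by omega
  simp only [haarMatrix, h0, if_false, hlog, hB, hB2]
  simp only [hr, hi', haarWave]
  push_cast
  rfl

theorem haarMatrix_mulVec {J l i : ℕ} (hl : l < J) (hi : i < 2 ^ l)
    {r : Fin (2 ^ J)} (hr : (r : ℕ) = 2 ^ l + i) (f : ℕ → ℝ) :
    (haarMatrix J).mulVec (fun c => f c) r = haarCoef (2 ^ (J - l - 1)) f i := by
  have hJ : 2 ^ J = 2 ^ l * (2 * 2 ^ (J - l - 1)) := by
    rw [← pow_succ', ← pow_add]; congr 1; omega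
  rw [← sum_haarWave_mul (Nat.two_pow_pos _) hi, ← hJ, Finset.sum_range]
  simp only [Matrix.mulVec, dotProduct, haarMatrix_eq_haarWave hl hi hr]

theorem levelNorm_eq {J l : ℕ} (hl : l < J) (α : Fin (2 ^ J) → ℝ) (g : ℕ → ℝ)
    (h : ∀ i < 2 ^ l, ∀ r : Fin (2 ^ J), (r : ℕ) = 2 ^ l + i → α r = g i) :
    levelNorm α l = ∑ i ∈ range (2 ^ l), |g i| := by
  have hJ : 2 ^ (l + 1) ≤ 2 ^ J := Nat.pow_le_pow_right (by norm_num) hl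
  rw [pow_succ] at hJ
  unfold levelNorm
  symm
  refine sum_bij' (fun i hi => ⟨2 ^ l + i, by have := mem_range.1 hi; omega⟩)
    (fun r _ => (r : ℕ) - 2 ^ l) ?_ ?_ ?_ ?_ ?_
  · intro i hi
    have := mem_range.1 hi
    simp only [mem_filter, mem_univ, true_and, pow_succ]; omega
  · intro r hr
    simp only [mem_filter, mem_univ, true_and, pow_succ] at hr
    rw [mem_range]; omega
  · intro i hi; simp
  · intro r hr
    simp only [mem_filter, mem_univ, true_and, pow_succ] at hr
    ext; simp only; omega
  · intro i hi
    rw [h i (mem_range.1 hi) _ rfl]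

/-! ### Parseval's identity and the total variation bound -/

/-- The parallelogram identity `(p - q)² / (2b) = (p² + q²) / b - (p + q)² / (2b)` writes the energy
of a level as a difference of block energies at consecutive scales, ready to telescope. -/
theorem sum_haarCoef_sq {b : ℕ} (hb : 0 < b) (f : ℕ → ℝ) (N : ℕ) :
    ∑ i ∈ range N, haarCoef b f i ^ 2 =
      ∑ i ∈ range (N * 2), blockSum f b i ^ 2 / b
        - ∑ i ∈ range N, blockSum f (2 * b) i ^ 2 / (2 * b) := by
  have hb' : (0 : ℝ) < b := by exact_mod_cast hb
  rw [sum_range_mul_eq_sum_blocks, ← sum_sub_distrib]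
  refine sum_congr rfl fun i _ => ?_
  rw [blockSum_two_mul, haarCoef, div_pow, Real.sq_sqrt (by positivity)]
  simp only [blockSum, sum_range_succ, sum_range_zero, mul_comm i 2, add_zero]
  field_simp
  ring

theorem sum_sq_eq_sum_haarCoef_sq (J : ℕ) (f : ℕ → ℝ) :
    ∑ j ∈ range (2 ^ J), f j ^ 2 = (∑ j ∈ range (2 ^ J), f j) ^ 2 / 2 ^ J +
      ∑ l ∈ range J, ∑ i ∈ range (2 ^ l), haarCoef (2 ^ (J - l - 1)) f i ^ 2 := by
  set F : ℕ → ℝ := fun l =>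
    ∑ i ∈ range (2 ^ l), blockSum f (2 ^ (J - l)) i ^ 2 / (2 ^ (J - l) : ℕ) with hF
  have h : ∀ l ∈ range J, ∑ i ∈ range (2 ^ l), haarCoef (2 ^ (J - l - 1)) f i ^ 2 =
      F (l + 1) - F l := by
    intro l hl
    have hl := mem_range.1 hl
    rw [sum_haarCoef_sq (Nat.two_pow_pos _)]
    have e1 : J - l - 1 = J - (l + 1) := by omega
    have e2 : 2 * 2 ^ (J - l - 1) = 2 ^ (J - l) := by rw [← pow_succ']; congr 1; omega
    have e3 : (2 : ℝ) * (2 ^ (J - l - 1) : ℕ) = (2 ^ (J - l) : ℕ) := by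
      rw [← e2]; push_cast; ring
    rw [e2, e3, e1, ← pow_succ]
  rw [sum_congr rfl h, sum_range_sub]
  simp [hF, blockSum]

theorem abs_sub_le_sum_abs (f : ℕ → ℝ) (a m : ℕ) :
    |f a - f (a + m)| ≤ ∑ s ∈ range m, |f (a + s + 1) - f (a + s)| := by
  have := sum_range_sub (fun s => f (a + s)) m
  rw [abs_sub_comm]
  have h : f (a + m) - f a = ∑ s ∈ range m, (f (a + s + 1) - f (a + s)) := by
    simpa [add_assoc] using this.symm
  rw [h]
  exact abs_sum_le_sum_abs _ _

/-- Each point of the left half is paired with the point `b` places to its right; each of the `b`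
differences is at most the variation over the block. -/
theorem abs_haarCoef_le {b : ℕ} (hb : 0 < b) (f : ℕ → ℝ) (i : ℕ) :
    |haarCoef b f i| ≤
      Real.sqrt (2 * b) / 2 * blockSum (fun s => |f (s + 1) - f s|) (2 * b) i := by
  have hb' : (0 : ℝ) < b := by exact_mod_cast hb
  set V := blockSum (fun s => |f (s + 1) - f s|) (2 * b) i with hV
  have h : |blockSum f b (2 * i) - blockSum f b (2 * i + 1)| ≤ b * V := by
    unfold blockSum
    rw [← sum_sub_distrib]
    refine (abs_sum_le_sum_abs _ _).trans ?_
    rw [← nsmul_eq_mul, ← card_range b, ← sum_const, card_range]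
    refine sum_le_sum fun j hj => ?_
    have hj := mem_range.1 hj
    have e : (2 * i + 1) * b + j = (2 * i * b + j) + b := by ring
    rw [e]
    refine (abs_sub_le_sum_abs f _ b).trans ?_
    rw [hV, blockSum]
    have e2 : ∑ s ∈ range b, |f (2 * i * b + j + s + 1) - f (2 * i * b + j + s)| =
        ∑ s ∈ Ico j (j + b), |f (i * (2 * b) + s + 1) - f (i * (2 * b) + s)| := by
      rw [sum_Ico_eq_sum_range, Nat.add_sub_cancel_left]
      refine sum_congr rfl fun s _ => ?_
      have : 2 * i * b + j + s = i * (2 * b) + (j + s) := by ring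
      rw [this]
    rw [e2]
    refine sum_le_sum_of_subset_of_nonneg ?_ fun _ _ _ => abs_nonneg _
    intro s hs
    rw [mem_Ico] at hs
    rw [mem_range]; omega
  have hp : 0 < Real.sqrt (2 * b) := by positivity
  rw [haarCoef, abs_div, abs_of_pos hp, div_le_iff₀ hp]
  have := Real.sq_sqrt (show (0 : ℝ) ≤ 2 * b by positivity)
  calc _ ≤ _ := h
    _ = Real.sqrt (2 * b) ^ 2 / 2 * V := by rw [this]; ring
    _ = _ := by ring

/-- The weight `√(2 ^ l)` exactly compensates the block length, so the bound is the same at all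
levels. This is why the restart statistic carries these weights. -/
theorem sum_abs_haarCoef_le {J l : ℕ} (hl : l < J) (f : ℕ → ℝ) :
    Real.sqrt (2 ^ l) * ∑ i ∈ range (2 ^ l), |haarCoef (2 ^ (J - l - 1)) f i| ≤
      Real.sqrt (2 ^ J) / 2 * ∑ s ∈ range (2 ^ J), |f (s + 1) - f s| := by
  have hJ : 2 ^ J = 2 ^ l * (2 * 2 ^ (J - l - 1)) := by
    rw [← pow_succ', ← pow_add]; congr 1; omega
  have hJ' : (2 : ℝ) ^ J = 2 ^ l * (2 * 2 ^ (J - l - 1)) := by exact_mod_cast hJ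
  have h : ∑ i ∈ range (2 ^ l), |haarCoef (2 ^ (J - l - 1)) f i| ≤
      Real.sqrt (2 * 2 ^ (J - l - 1)) / 2 * ∑ s ∈ range (2 ^ J), |f (s + 1) - f s| := by
    rw [hJ, sum_range_mul_eq_sum_blocks, mul_sum]
    refine sum_le_sum fun i _ => ?_
    simpa using abs_haarCoef_le (Nat.two_pow_pos (J - l - 1)) f i
  calc _ ≤ _ := mul_le_mul_of_nonneg_left h (Real.sqrt_nonneg _)
    _ = _ := by rw [hJ', Real.sqrt_mul (by positivity) (2 * 2 ^ (J - l - 1))]; ring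

/-! ### Hölder's inequality and soft thresholding -/

/-- Hölder with exponents `3` and `3/2`. It serves twice: over the coefficients of one level, and
over the bins with their lengths and variations. -/
theorem sum_rpow_third_mul_le {ι : Type*} (s : Finset ι) (x y : ι → ℝ)
    (hx : ∀ i ∈ s, 0 ≤ x i) (hy : ∀ i ∈ s, 0 ≤ y i) :
    ∑ i ∈ s, x i ^ (1 / 3 : ℝ) * y i ^ (2 / 3 : ℝ) ≤
      (∑ i ∈ s, x i) ^ (1 / 3 : ℝ) * (∑ i ∈ s, y i) ^ (2 / 3 : ℝ) := by
  have hpq : (3 : ℝ).HolderConjugate (3 / 2) := by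
    rw [Real.holderConjugate_iff]; norm_num
  have h := Real.inner_le_Lp_mul_Lq_of_nonneg s hpq
    (f := fun i => x i ^ (1 / 3 : ℝ)) (g := fun i => y i ^ (2 / 3 : ℝ))
    (fun i hi => Real.rpow_nonneg (hx i hi) _) (fun i hi => Real.rpow_nonneg (hy i hi) _)
  have e1 : ∑ i ∈ s, (x i ^ (1 / 3 : ℝ)) ^ (3 : ℝ) = ∑ i ∈ s, x i :=
    sum_congr rfl fun i hi => by rw [← Real.rpow_mul (hx i hi)]; norm_num
  have e2 : ∑ i ∈ s, (y i ^ (2 / 3 : ℝ)) ^ (3 / 2 : ℝ) = ∑ i ∈ s, y i :=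
    sum_congr rfl fun i hi => by rw [← Real.rpow_mul (hy i hi)]; norm_num
  rw [e1, e2] at h
  convert h using 3
  norm_num

theorem abs_softThreshold {lam : ℝ} (hl : 0 ≤ lam) (x : ℝ) :
    |softThreshold lam x| = max (|x| - lam) 0 := by
  unfold softThreshold
  have h := le_max_right (|x| - lam) 0
  rcases lt_trichotomy x 0 with hx | rfl | hx
  · rw [Real.sign_of_neg hx, neg_one_mul, abs_neg, abs_of_nonneg h]
  · simp [hl]
  · rw [Real.sign_of_pos hx, one_mul, abs_of_nonneg h]

theorem abs_softThreshold_add_le {lam a e : ℝ} (he : |e| ≤ lam) :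
    |softThreshold lam (a + e)| ≤ |a| := by
  rw [abs_softThreshold ((abs_nonneg e).trans he)]
  have := abs_add_le a e
  exact max_le (by linarith) (abs_nonneg a)

/-- If `|a| ≤ 4 lam`, then `a² = |a|^(4/3) |a|^(2/3)` and the first factor is bounded by the
threshold. Otherwise thresholding removes at most `2 lam ≤ |a| / 2`, noise included, so half of
`|a|` survives. -/
theorem sq_le_softThreshold_add {lam a e : ℝ} (he : |e| ≤ lam) :
    a ^ 2 ≤ 4 * |softThreshold lam (a + e)| ^ 2 +
      (4 * lam) ^ (4 / 3 : ℝ) * |a| ^ (2 / 3 : ℝ) := by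
  have hl : 0 ≤ lam := (abs_nonneg e).trans he
  rw [abs_softThreshold hl]
  have h1 : |a| - |e| ≤ |a + e| := by
    have := abs_sub_abs_le_abs_sub a (-e); simpa using this
  rcases le_total |a| (4 * lam) with h | h
  · have : a ^ 2 = |a| ^ (4 / 3 : ℝ) * |a| ^ (2 / 3 : ℝ) := by
      rw [← Real.rpow_add_of_nonneg (abs_nonneg a) (by norm_num) (by norm_num), ← sq_abs,
        ← Real.rpow_natCast]
      norm_num
    rw [this]
    have h2 : |a| ^ (4 / 3 : ℝ) ≤ (4 * lam) ^ (4 / 3 : ℝ) :=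
      Real.rpow_le_rpow (abs_nonneg a) h (by norm_num)
    have h3 := mul_le_mul_of_nonneg_right h2 (Real.rpow_nonneg (abs_nonneg a) (2 / 3 : ℝ))
    nlinarith [sq_nonneg (max (|a + e| - lam) 0)]
  · have h2 : |a| / 2 ≤ max (|a + e| - lam) 0 := le_max_of_le_left (by linarith)
    have h3 : (|a| / 2) ^ 2 ≤ (max (|a + e| - lam) 0) ^ 2 :=
      pow_le_pow_left₀ (by positivity) h2 2
    have h4 : 0 ≤ (4 * lam) ^ (4 / 3 : ℝ) * |a| ^ (2 / 3 : ℝ) := by positivity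
    rw [← sq_abs a]
    nlinarith

/-! ### Averages -/

theorem avg_mul_card (y : ℕ → ℝ) {a b : ℕ} (hab : a ≤ b) :
    ((b + 1 - a : ℕ) : ℝ) * avg y a b = ∑ s ∈ Icc a b, y s := by
  have : ((b + 1 - a : ℕ) : ℝ) ≠ 0 := by
    have : b + 1 - a ≠ 0 := by omega
    exact_mod_cast this
  rw [avg, mul_div_cancel₀ _ this]

theorem avg_add (y z : ℕ → ℝ) (a b : ℕ) :
    avg (fun t => y t + z t) a b = avg y a b + avg z a b := by
  simp only [avg, sum_add_distrib, add_div]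

theorem abs_sub_le_variation (θ : ℕ → ℝ) {a b s t : ℕ} (has : a ≤ s) (hst : s ≤ t) (htb : t ≤ b) :
    |θ t - θ s| ≤ ∑ u ∈ Ico a b, |θ (u + 1) - θ u| := by
  rw [← sum_Ico_sub θ hst]
  refine (abs_sum_le_sum_abs _ _).trans ?_
  refine sum_le_sum_of_subset_of_nonneg (Ico_subset_Ico has htb) fun _ _ _ => abs_nonneg _

theorem abs_sub_avg_le (θ : ℕ → ℝ) {a b : ℕ} (hab : a ≤ b) {c V : ℝ}
    (h : ∀ s ∈ Icc a b, |c - θ s| ≤ V) : |c - avg θ a b| ≤ V := by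
  have hL : (0 : ℝ) < ((b + 1 - a : ℕ) : ℝ) := by
    have : 0 < b + 1 - a := by omega
    exact_mod_cast this
  have e : ((b + 1 - a : ℕ) : ℝ) * (c - avg θ a b) = ∑ s ∈ Icc a b, (c - θ s) := by
    rw [mul_sub, avg_mul_card θ hab, sum_sub_distrib, sum_const, Nat.card_Icc, nsmul_eq_mul]
  have h2 : |∑ s ∈ Icc a b, (c - θ s)| ≤ ((b + 1 - a : ℕ) : ℝ) * V := by
    refine (abs_sum_le_sum_abs _ _).trans ((sum_le_sum h).trans ?_)
    rw [sum_const, Nat.card_Icc, nsmul_eq_mul]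
  rw [← e, abs_mul, abs_of_pos hL] at h2
  exact le_of_mul_le_mul_left h2 hL

theorem sum_sq_sub_avg (θ : ℕ → ℝ) {a b : ℕ} (hab : a ≤ b) :
    ∑ t ∈ Icc a b, (θ t - avg θ a b) ^ 2 =
      ∑ t ∈ Icc a b, θ t ^ 2 - ((b + 1 - a : ℕ) : ℝ) * avg θ a b ^ 2 := by
  have h := avg_mul_card θ hab
  have : ∀ t ∈ Icc a b, (θ t - avg θ a b) ^ 2 = θ t ^ 2 - 2 * avg θ a b * θ t + avg θ a b ^ 2 :=
    fun t _ => by ring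
  rw [sum_congr rfl this, sum_add_distrib, sum_sub_distrib, ← mul_sum, ← h, sum_const,
    Nat.card_Icc, nsmul_eq_mul]
  ring

/-- The squared errors of the running averages are controlled by the empirical variance. -/
theorem sum_sq_sub_running_avg_le (θ : ℕ → ℝ) {a b : ℕ} (hab : a ≤ b) :
    ∑ t ∈ Ioc a b, (θ t - avg θ a (t - 1)) ^ 2 ≤ 2 * ∑ t ∈ Icc a b, (θ t - avg θ a b) ^ 2 := by
  induction b, hab using Nat.le_induction with
  | base => simp [sq_nonneg]
  | succ b hab ih =>
    rw [sum_Ioc_succ_top hab]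
    rw [sum_sq_sub_avg θ hab] at ih
    have h1 := avg_mul_card θ hab
    have h2 := avg_mul_card θ (show a ≤ b + 1 by omega)
    rw [sum_sq_sub_avg θ (by omega)]
    have e : ∀ f : ℕ → ℝ, ∑ s ∈ Icc a (b + 1), f s = ∑ s ∈ Icc a b, f s + f (b + 1) :=
      fun f => sum_Icc_succ_top (by omega) f
    rw [e, ← h1] at h2
    rw [e, Nat.add_sub_cancel]
    have hm : ((b + 1 + 1 - a : ℕ) : ℝ) = ((b + 1 - a : ℕ) : ℝ) + 1 := by
      rw [show b + 1 + 1 - a = (b + 1 - a) + 1 by omega]; push_cast; ring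
    have hm1 : (1 : ℝ) ≤ ((b + 1 - a : ℕ) : ℝ) := by
      have : 1 ≤ b + 1 - a := by omega
      exact_mod_cast this
    rw [hm] at h2 ⊢
    set m : ℝ := ((b + 1 - a : ℕ) : ℝ)
    set u := avg θ a b
    set v := avg θ a (b + 1)
    set x := θ (b + 1)
    have hx : x = (m + 1) * v - m * u := by linarith
    -- The new term raises the sum of squared deviations by `m / (m + 1) * (x - u)²`, and `m / (m +
    -- 1) ≥ 1 / 2` gives the factor `2`.
    have key : (x - u) ^ 2 ≤ 2 * (m * u ^ 2 + x ^ 2 - (m + 1) * v ^ 2) := by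
      rw [hx]
      nlinarith [mul_nonneg (sub_nonneg.2 hm1) (sq_nonneg (v - u)),
        mul_nonneg (mul_nonneg (sub_nonneg.2 hm1) (sub_nonneg.2 hm1)) (sq_nonneg (v - u))]
    linarith

/-! ### The recentred and padded sequence -/

/-- The sequence `y a, …, y b`, recentred by its average and continued by zeros. -/
noncomputable def padSeq (y : ℕ → ℝ) (a b : ℕ) : ℕ → ℝ :=
  fun j => if a + j ≤ b then y (a + j) - avg y a b else 0

theorem le_two_pow_padExp (a b : ℕ) : b + 1 - a ≤ 2 ^ padExp a b :=
  Nat.le_pow_clog (by norm_num) _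

theorem two_pow_padExp_le {a b : ℕ} (hab : a ≤ b) : 2 ^ padExp a b ≤ 2 * (b + 1 - a) := by
  unfold padExp
  rcases Nat.lt_or_ge 1 (b + 1 - a) with h | h
  · have h1 := Nat.pow_pred_clog_lt_self (b := 2) (by norm_num) h
    have h2 : 0 < Nat.clog 2 (b + 1 - a) := Nat.clog_pos (by norm_num) h
    obtain ⟨k, hk⟩ := Nat.exists_eq_succ_of_ne_zero h2.ne'
    rw [hk] at h1 ⊢
    simp only [Nat.pred_succ] at h1
    rw [Nat.succ_eq_add_one, pow_succ]; omega
  · have : b + 1 - a = 1 := by omega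
    simp [this]

theorem sum_range_ite_eq_sum_Icc (g : ℕ → ℝ) {a b M : ℕ} (hM : b + 1 - a ≤ M) :
    ∑ j ∈ range M, (if a + j ≤ b then g (a + j) else 0) = ∑ t ∈ Icc a b, g t := by
  have h : ∑ t ∈ Icc a b, g t = ∑ j ∈ range (b + 1 - a), g (a + j) := by
    rw [← sum_Ico_eq_sum_range]; rfl
  rw [← sum_filter, h]
  refine sum_congr ?_ fun _ _ => rfl
  ext j
  simp only [mem_filter, mem_range]; omega

theorem padSeq_add (y z : ℕ → ℝ) (a b j : ℕ) :
    padSeq (fun t => y t + z t) a b j = padSeq y a b j + padSeq z a b j := by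
  unfold padSeq
  rw [avg_add]
  split_ifs <;> ring

theorem blockSum_add (f g : ℕ → ℝ) (b i : ℕ) :
    blockSum (fun j => f j + g j) b i = blockSum f b i + blockSum g b i :=
  sum_add_distrib

theorem haarCoef_add (f g : ℕ → ℝ) (b i : ℕ) :
    haarCoef b (fun j => f j + g j) i = haarCoef b f i + haarCoef b g i := by
  unfold haarCoef
  rw [blockSum_add, blockSum_add]; ring

theorem haarCoef_padSeq_add (y z : ℕ → ℝ) (a b c i : ℕ) :
    haarCoef c (padSeq (fun t => y t + z t) a b) i =
      haarCoef c (padSeq y a b) i + haarCoef c (padSeq z a b) i := by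
  rw [← haarCoef_add]
  congr 1
  exact funext fun j => padSeq_add y z a b j

theorem sum_padSeq (y : ℕ → ℝ) {a b : ℕ} (hab : a ≤ b) :
    ∑ j ∈ range (2 ^ padExp a b), padSeq y a b j = 0 := by
  unfold padSeq
  rw [sum_range_ite_eq_sum_Icc (fun t => y t - avg y a b) (le_two_pow_padExp a b),
    sum_sub_distrib, ← avg_mul_card y hab, sum_const, Nat.card_Icc, nsmul_eq_mul, sub_self]

theorem sum_padSeq_sq (y : ℕ → ℝ) (a b : ℕ) :
    ∑ j ∈ range (2 ^ padExp a b), padSeq y a b j ^ 2 = ∑ t ∈ Icc a b, (y t - avg y a b) ^ 2 := by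
  rw [← sum_range_ite_eq_sum_Icc (fun t => (y t - avg y a b) ^ 2) (le_two_pow_padExp a b)]
  refine sum_congr rfl fun j _ => ?_
  unfold padSeq
  split_ifs <;> simp

/-- Recentring kills the constant Haar coefficient, so only wavelet terms remain in Parseval's
identity. -/
theorem sum_sq_sub_avg_eq_sum_haarCoef (y : ℕ → ℝ) {a b : ℕ} (hab : a ≤ b) :
    ∑ t ∈ Icc a b, (y t - avg y a b) ^ 2 = ∑ l ∈ range (padExp a b), ∑ i ∈ range (2 ^ l),
      haarCoef (2 ^ (padExp a b - l - 1)) (padSeq y a b) i ^ 2 := by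
  rw [← sum_padSeq_sq, sum_sq_eq_sum_haarCoef_sq, sum_padSeq y hab]
  simp

/-- The factor `2` pays for the drop to the zero padding, of size `|θ b - avg θ a b|`, which is
itself at most the variation. -/
theorem variation_padSeq_le (θ : ℕ → ℝ) {a b : ℕ} (hab : a ≤ b) :
    ∑ s ∈ range (2 ^ padExp a b), |padSeq θ a b (s + 1) - padSeq θ a b s| ≤
      2 * ∑ u ∈ Ico a b, |θ (u + 1) - θ u| := by
  have h : ∀ s ∈ range (2 ^ padExp a b), |padSeq θ a b (s + 1) - padSeq θ a b s| =
      if a + s ≤ b then (fun t => if t < b then |θ (t + 1) - θ t| else |θ b - avg θ a b|) (a + s)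
      else 0 := by
    intro s _
    unfold padSeq
    rcases lt_trichotomy (a + s) b with h | h | h
    · rw [if_pos (show a + (s + 1) ≤ b by omega), if_pos h.le, if_pos h.le]
      simp [h, ← add_assoc]
    · rw [if_neg (show ¬ a + (s + 1) ≤ b by omega), if_pos h.le, if_pos h.le]
      simp [h, abs_sub_comm]
    · rw [if_neg (show ¬ a + (s + 1) ≤ b by omega), if_neg (by omega), if_neg (by omega)]
      simp
  rw [sum_congr rfl h, sum_range_ite_eq_sum_Icc
    (fun t => if t < b then |θ (t + 1) - θ t| else |θ b - avg θ a b|) (le_two_pow_padExp a b)]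
  have e : Icc a b = Ico a (b + 1) := rfl
  rw [e, sum_Ico_succ_top hab, if_neg (lt_irrefl b), two_mul]
  have h2 : |θ b - avg θ a b| ≤ ∑ u ∈ Ico a b, |θ (u + 1) - θ u| :=
    abs_sub_avg_le θ hab fun s hs => by
      rw [mem_Icc] at hs
      exact abs_sub_le_variation θ hs.1 hs.2 le_rfl
  refine add_le_add (le_of_eq (sum_congr rfl fun t ht => ?_)) h2
  rw [if_pos (mem_Ico.1 ht).2]

/-- The Haar coefficients of a recentred segment are linear functionals of norm at most one. -/
theorem exists_haarCoef_padSeq_eq_sum {a b n l i : ℕ} (ha : 1 ≤ a) (hab : a ≤ b) (hb : b ≤ n)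
    (hl : l < padExp a b) (hi : i < 2 ^ l) :
    ∃ w : ℕ → ℝ, ∑ s ∈ Icc 1 n, w s ^ 2 ≤ 1 ∧ ∀ z : ℕ → ℝ,
      haarCoef (2 ^ (padExp a b - l - 1)) (padSeq z a b) i = ∑ s ∈ Icc 1 n, w s * z s := by
  set J := padExp a b with hJdef
  have hJ : 2 ^ J = 2 ^ l * (2 * 2 ^ (J - l - 1)) := by
    rw [← pow_succ', ← pow_add]; congr 1; omega
  set ψ : ℕ → ℝ := fun t => haarWave (2 ^ (J - l - 1)) i (t - a) with hψ
  have hext : ∀ g : ℕ → ℝ, ∑ s ∈ Icc 1 n, (if s ∈ Icc a b then g s else 0) = ∑ s ∈ Icc a b, g s := by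
    intro g
    rw [← sum_filter]
    refine sum_congr ?_ fun _ _ => rfl
    ext s
    simp only [mem_filter, mem_Icc]; omega
  have hψ1 : ∑ t ∈ Icc a b, ψ t ^ 2 ≤ 1 := by
    rw [← sum_haarWave_sq (Nat.two_pow_pos (J - l - 1)) hi, ← hJ,
      ← sum_range_ite_eq_sum_Icc _ (le_two_pow_padExp a b)]
    refine sum_le_sum fun j _ => ?_
    simp only [hψ, Nat.add_sub_cancel_left]
    split_ifs
    · exact le_rfl
    · positivity
  -- Recentring is self-adjoint, so it can be moved from `z` to the wavelet cut off to the segment;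
  -- neither the cut nor the recentring increases the norm.
  refine ⟨fun s => if s ∈ Icc a b then ψ s - avg ψ a b else 0, ?_, fun z => ?_⟩
  · simp only [ite_pow, ne_eq, OfNat.ofNat_ne_zero, not_false_eq_true, zero_pow]
    rw [hext fun s => (ψ s - avg ψ a b) ^ 2, sum_sq_sub_avg ψ hab]
    have : 0 ≤ ((b + 1 - a : ℕ) : ℝ) * avg ψ a b ^ 2 := by positivity
    linarith
  · simp only [ite_mul, zero_mul]
    rw [hext fun s => (ψ s - avg ψ a b) * z s,
      ← sum_haarWave_mul (Nat.two_pow_pos (J - l - 1)) hi, ← hJ]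
    have h1 : ∑ c ∈ range (2 ^ J), haarWave (2 ^ (J - l - 1)) i c * padSeq z a b c =
        ∑ t ∈ Icc a b, ψ t * (z t - avg z a b) := by
      rw [← sum_range_ite_eq_sum_Icc (fun t => ψ t * (z t - avg z a b)) (le_two_pow_padExp a b)]
      refine sum_congr rfl fun c _ => ?_
      simp only [padSeq, hψ, Nat.add_sub_cancel_left, mul_ite, mul_zero]
    rw [h1]
    simp only [mul_sub, sub_mul, sum_sub_distrib, ← sum_mul, ← mul_sum]
    rw [← avg_mul_card ψ hab, ← avg_mul_card z hab]
    ring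

/-! ### The restart rule -/

theorem coeffs_eq {n : ℕ} {σ β : ℝ} (y : ℕ → ℝ) {a b l i : ℕ} (hl : l < padExp a b)
    (hi : i < 2 ^ l) {r : Fin (2 ^ padExp a b)} (hr : (r : ℕ) = 2 ^ l + i) :
    coeffs n σ β y a b r = softThreshold (σ * Real.sqrt (β * Real.log n))
      (haarCoef (2 ^ (padExp a b - l - 1)) (padSeq y a b) i) := by
  rw [coeffs, ← haarMatrix_mulVec hl hi hr (padSeq y a b)]
  rfl

theorem restart_iff (n : ℕ) (σ β : ℝ) (y : ℕ → ℝ) (a b : ℕ) :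
    Restart n σ β y a b ↔ σ < ∑ l ∈ range (padExp a b), Real.sqrt (2 ^ l) *
      ∑ i ∈ range (2 ^ l), |softThreshold (σ * Real.sqrt (β * Real.log n))
        (haarCoef (2 ^ (padExp a b - l - 1)) (padSeq y a b) i)| := by
  have hp : 0 < Real.sqrt (2 ^ padExp a b) := by positivity
  have h : ∀ l ∈ range (padExp a b), Real.sqrt (2 ^ l) * levelNorm (coeffs n σ β y a b) l =
      Real.sqrt (2 ^ l) * ∑ i ∈ range (2 ^ l), |softThreshold (σ * Real.sqrt (β * Real.log n))
        (haarCoef (2 ^ (padExp a b - l - 1)) (padSeq y a b) i)| := by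
    intro l hl
    rw [levelNorm_eq (mem_range.1 hl) _ _ fun i hi r hr => coeffs_eq y (mem_range.1 hl) hi hr]
  rw [Restart, sum_congr rfl h, one_div_mul_eq_div, div_lt_div_iff_of_pos_right hp]

theorem sum_abs_haarCoef_padSeq_le (θ : ℕ → ℝ) {a b l : ℕ} (hab : a ≤ b) (hl : l < padExp a b) :
    Real.sqrt (2 ^ l) *
        ∑ i ∈ range (2 ^ l), |haarCoef (2 ^ (padExp a b - l - 1)) (padSeq θ a b) i| ≤
      Real.sqrt (2 ^ padExp a b) * ∑ u ∈ Ico a b, |θ (u + 1) - θ u| := by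
  refine (sum_abs_haarCoef_le hl _).trans ?_
  have := mul_le_mul_of_nonneg_left (variation_padSeq_le θ hab)
    (show 0 ≤ Real.sqrt (2 ^ padExp a b) / 2 by positivity)
  linarith

section Bin

variable {n : ℕ} {σ β : ℝ} {θ z : ℕ → ℝ} {a b : ℕ}

/-- A restart forces the underlying sequence to vary within the bin. -/
theorem le_variation_of_restart (hab : a ≤ b)
    (hz : ∀ l < padExp a b, ∀ i < 2 ^ l,
      |haarCoef (2 ^ (padExp a b - l - 1)) (padSeq z a b) i| ≤ σ * Real.sqrt (β * Real.log n))
    (hr : Restart n σ β (fun t => θ t + z t) a b) :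
    σ ≤ padExp a b * (Real.sqrt (2 ^ padExp a b) * ∑ u ∈ Ico a b, |θ (u + 1) - θ u|) := by
  rw [restart_iff] at hr
  refine hr.le.trans ?_
  rw [← nsmul_eq_mul]
  conv_rhs => rw [← card_range (padExp a b)]
  rw [← sum_const, card_range]
  refine sum_le_sum fun l hl => ?_
  have hl := mem_range.1 hl
  refine le_trans ?_ (sum_abs_haarCoef_padSeq_le θ hab hl)
  refine mul_le_mul_of_nonneg_left (sum_le_sum fun i hi => ?_) (Real.sqrt_nonneg _)
  rw [haarCoef_padSeq_add]
  exact abs_softThreshold_add_le (hz l hl i (mem_range.1 hi))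

/-- The inequality `σ ≤ J √k V`, raised to the power `2/3` and multiplied by `σ^(4/3)`. In this form
the overhead `σ²` of a bin is summable over bins by the same Hölder inequality as the main term. -/
theorem sq_le_variation_of_restart (hσ : 0 ≤ σ) (hab : a ≤ b)
    (hz : ∀ l < padExp a b, ∀ i < 2 ^ l,
      |haarCoef (2 ^ (padExp a b - l - 1)) (padSeq z a b) i| ≤ σ * Real.sqrt (β * Real.log n))
    (hr : Restart n σ β (fun t => θ t + z t) a b) :
    σ ^ 2 ≤ σ ^ (4 / 3 : ℝ) * (padExp a b * ((2 ^ padExp a b) ^ (1 / 3 : ℝ) *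
      (∑ u ∈ Ico a b, |θ (u + 1) - θ u|) ^ (2 / 3 : ℝ))) := by
  have h := le_variation_of_restart hab hz hr
  have hJ : (1 : ℝ) ≤ padExp a b := by
    rcases Nat.eq_zero_or_pos (padExp a b) with h0 | h0
    · rw [restart_iff, h0] at hr
      simp at hr
      linarith
    · exact_mod_cast h0
  set V := ∑ u ∈ Ico a b, |θ (u + 1) - θ u|
  have hV : 0 ≤ V := sum_nonneg fun _ _ => abs_nonneg _
  set J := padExp a b
  have e : σ ^ 2 = σ ^ (4 / 3 : ℝ) * σ ^ (2 / 3 : ℝ) := by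
    rw [← Real.rpow_add_of_nonneg hσ (by norm_num) (by norm_num), ← Real.rpow_natCast]
    norm_num
  rw [e]
  refine mul_le_mul_of_nonneg_left ?_ (by positivity)
  calc σ ^ (2 / 3 : ℝ) ≤ (J * (Real.sqrt (2 ^ J) * V)) ^ (2 / 3 : ℝ) :=
        Real.rpow_le_rpow hσ h (by norm_num)
    _ = (J : ℝ) ^ (2 / 3 : ℝ) * ((2 ^ J) ^ (1 / 3 : ℝ) * V ^ (2 / 3 : ℝ)) := by
        rw [Real.mul_rpow (by positivity) (by positivity),
          Real.mul_rpow (by positivity) (by positivity), Real.sqrt_eq_rpow,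
          ← Real.rpow_mul (by positivity)]
        norm_num
    _ ≤ _ := by
        refine mul_le_mul_of_nonneg_right ?_ (by positivity)
        calc (J : ℝ) ^ (2 / 3 : ℝ) ≤ (J : ℝ) ^ (1 : ℝ) :=
              Real.rpow_le_rpow_of_exponent_le hJ (by norm_num)
          _ = J := Real.rpow_one _

/-- As long as no restart is triggered, the empirical variance of the underlying sequence
in the bin is small. -/
theorem sum_sq_sub_avg_le_of_not_restart (hab : a ≤ b)
    (hz : ∀ l < padExp a b, ∀ i < 2 ^ l,
      |haarCoef (2 ^ (padExp a b - l - 1)) (padSeq z a b) i| ≤ σ * Real.sqrt (β * Real.log n))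
    (hr : ¬ Restart n σ β (fun t => θ t + z t) a b) :
    ∑ t ∈ Icc a b, (θ t - avg θ a b) ^ 2 ≤ 4 * σ ^ 2 +
      (4 * (σ * Real.sqrt (β * Real.log n))) ^ (4 / 3 : ℝ) *
        (padExp a b * ((2 ^ padExp a b) ^ (1 / 3 : ℝ) *
          (∑ u ∈ Ico a b, |θ (u + 1) - θ u|) ^ (2 / 3 : ℝ))) := by
  rw [restart_iff, not_lt] at hr
  set lam := σ * Real.sqrt (β * Real.log n)
  set V := ∑ u ∈ Ico a b, |θ (u + 1) - θ u| with hVdef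
  have hV : 0 ≤ V := sum_nonneg fun _ _ => abs_nonneg _
  set J := padExp a b with hJ
  set A : ℕ → ℕ → ℝ := fun l i => haarCoef (2 ^ (J - l - 1)) (padSeq θ a b) i with hA
  set S : ℕ → ℕ → ℝ := fun l i => |softThreshold lam
    (haarCoef (2 ^ (J - l - 1)) (padSeq (fun t => θ t + z t) a b) i)| with hS
  have hS0 : ∀ l i, 0 ≤ S l i := fun _ _ => abs_nonneg _
  -- The weights are at least `1`, and the `ℓ²` norm is at most the `ℓ¹` norm, within a level and
  -- then across levels. Hence the thresholded energy is at most `σ²`.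
  have h1 : ∀ l ∈ range J, ∑ i ∈ range (2 ^ l), S l i ^ 2 ≤
      (Real.sqrt (2 ^ l) * ∑ i ∈ range (2 ^ l), S l i) ^ 2 := by
    intro l _
    have h2 : ∑ i ∈ range (2 ^ l), S l i ^ 2 ≤ (∑ i ∈ range (2 ^ l), S l i) ^ 2 :=
      sum_sq_le_sq_sum_of_nonneg fun i _ => hS0 l i
    have h3 : (1 : ℝ) ≤ 2 ^ l := one_le_pow₀ (by norm_num)
    rw [mul_pow, Real.sq_sqrt (by positivity)]
    nlinarith [sq_nonneg (∑ i ∈ range (2 ^ l), S l i)]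
  have h2 : ∑ l ∈ range J, ∑ i ∈ range (2 ^ l), S l i ^ 2 ≤ σ ^ 2 := by
    have hn : ∀ l ∈ range J, 0 ≤ Real.sqrt (2 ^ l) * ∑ i ∈ range (2 ^ l), S l i :=
      fun l _ => mul_nonneg (Real.sqrt_nonneg _) (sum_nonneg fun i _ => hS0 l i)
    calc _ ≤ _ := sum_le_sum h1
      _ ≤ _ := sum_sq_le_sq_sum_of_nonneg hn
      _ ≤ _ := pow_le_pow_left₀ (sum_nonneg hn) hr 2
  -- Hölder against the constant `1` produces `(2 ^ l)^(1/3)`, which is the power `2/3` of the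
  -- weight `√(2 ^ l)` in the variation bound.
  have h3 : ∀ l ∈ range J, ∑ i ∈ range (2 ^ l), |A l i| ^ (2 / 3 : ℝ) ≤
      (2 ^ J) ^ (1 / 3 : ℝ) * V ^ (2 / 3 : ℝ) := by
    intro l hl
    have hT := sum_abs_haarCoef_padSeq_le θ hab (mem_range.1 hl)
    have hH := sum_rpow_third_mul_le (range (2 ^ l)) (fun _ => (1 : ℝ)) (fun i => |A l i|)
      (fun _ _ => zero_le_one) (fun _ _ => abs_nonneg _)
    simp only [Real.one_rpow, one_mul, sum_const, card_range, nsmul_eq_mul, mul_one] at hH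
    refine hH.trans ?_
    have hsum : 0 ≤ ∑ i ∈ range (2 ^ l), |A l i| := sum_nonneg fun _ _ => abs_nonneg _
    have e : ∀ (m : ℕ) (x : ℝ), 0 ≤ x →
        ((2 : ℝ) ^ m) ^ (1 / 3 : ℝ) * x ^ (2 / 3 : ℝ) = (Real.sqrt (2 ^ m) * x) ^ (2 / 3 : ℝ) := by
      intro m x hx
      rw [Real.mul_rpow (by positivity) hx, Real.sqrt_eq_rpow, ← Real.rpow_mul (by positivity)]
      norm_num
    push_cast
    rw [e _ _ hsum, e _ _ hV]
    exact Real.rpow_le_rpow (by positivity) hT (by norm_num)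
  have h4 : ∀ l ∈ range J, ∀ i ∈ range (2 ^ l), A l i ^ 2 ≤
      4 * S l i ^ 2 + (4 * lam) ^ (4 / 3 : ℝ) * |A l i| ^ (2 / 3 : ℝ) := by
    intro l hl i hi
    simp only [hS, hA, haarCoef_padSeq_add]
    exact sq_le_softThreshold_add (hz l (mem_range.1 hl) i (mem_range.1 hi))
  rw [sum_sq_sub_avg_eq_sum_haarCoef θ hab]
  rcases Nat.eq_zero_or_pos J with h0 | h0
  · rw [← hJ, h0]; simp; positivity
  have hlam : 0 ≤ lam := (abs_nonneg _).trans (hz 0 h0 0 (by norm_num))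
  calc _ ≤ ∑ l ∈ range J, ∑ i ∈ range (2 ^ l),
        (4 * S l i ^ 2 + (4 * lam) ^ (4 / 3 : ℝ) * |A l i| ^ (2 / 3 : ℝ)) :=
        sum_le_sum fun l hl => sum_le_sum fun i hi => h4 l hl i hi
    _ = 4 * ∑ l ∈ range J, ∑ i ∈ range (2 ^ l), S l i ^ 2 + (4 * lam) ^ (4 / 3 : ℝ) *
          ∑ l ∈ range J, ∑ i ∈ range (2 ^ l), |A l i| ^ (2 / 3 : ℝ) := by
        simp only [sum_add_distrib, mul_sum]
    _ ≤ _ := by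
        have h5 := sum_le_sum h3
        rw [sum_const, card_range, nsmul_eq_mul] at h5
        have h6 := mul_le_mul_of_nonneg_left h5
          (show 0 ≤ (4 * lam) ^ (4 / 3 : ℝ) by positivity)
        linarith

end Bin

/-! ### The good event -/

section Probability

open MeasureTheory ProbabilityTheory

variable {Ω : Type*} [MeasurableSpace Ω] {μ : Measure Ω} [IsProbabilityMeasure μ]
  {n : ℕ} {σ : NNReal} {Z : ℕ → Ω → ℝ}

/-- By independence the weighted sum is subgaussian with parameter at most `σ²`; Chernoff is applied
to it and to its negative. -/
theorem measureReal_lt_abs_sum_le (hindep : iIndepFun (fun t : Finset.Icc 1 n => Z t) μ)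
    (hZ : ∀ t ∈ Finset.Icc 1 n, HasSubgaussianMGF (Z t) (σ ^ 2) μ) {w : ℕ → ℝ}
    (hw : ∑ s ∈ Icc 1 n, w s ^ 2 ≤ 1) {x : ℝ} (hx : 0 ≤ x) :
    μ.real {ω | σ * x < |∑ s ∈ Icc 1 n, w s * Z s ω|} ≤ 2 * Real.exp (-x ^ 2 / 2) := by
  set X : Ω → ℝ := fun ω => ∑ s ∈ Icc 1 n, w s * Z s ω with hXdef
  obtain ⟨c, hc, hX⟩ : ∃ c : NNReal, (c : ℝ) ≤ σ ^ 2 ∧ HasSubgaussianMGF X c μ := by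
    have h1 : iIndepFun (fun (t : Finset.Icc 1 n) ω => w t * Z t ω) μ :=
      hindep.comp (fun t x => w t * x) fun t => measurable_const_mul _
    have h2 := HasSubgaussianMGF.sum_of_iIndepFun h1 (s := univ)
      fun t _ => (hZ t t.2).const_mul (w t)
    refine ⟨_, ?_, h2.congr (Filter.Eventually.of_forall fun ω => ?_)⟩
    · rw [NNReal.coe_sum]
      calc _ = ∑ t : Finset.Icc 1 n, w t ^ 2 * (σ : ℝ) ^ 2 := sum_congr rfl fun t _ => rfl
        _ = (∑ s ∈ Icc 1 n, w s ^ 2) * (σ : ℝ) ^ 2 := by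
            rw [← sum_mul, Finset.sum_coe_sort (Icc 1 n) (fun s => w s ^ 2)]
        _ ≤ _ := by nlinarith [sq_nonneg (σ : ℝ)]
    · exact Finset.sum_coe_sort (Icc 1 n) (fun s => w s * Z s ω)
  have hε : 0 ≤ (σ : ℝ) * x := by positivity
  -- For `c = 0` the Chernoff exponent is a division by zero, hence useless; the sum vanishes almost
  -- surely instead.
  rcases eq_or_ne c 0 with rfl | h0
  · have h3 : μ {ω | σ * x < |X ω|} = 0 := by
      refine measure_mono_null ?_ (ae_iff.1 hX.ae_eq_zero_of_hasSubgaussianMGF_zero)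
      intro ω hω h4
      simp only [Set.mem_ofPred_eq, h4, Pi.zero_apply, abs_zero] at hω
      linarith
    rw [Measure.real, h3]
    simp [Real.exp_nonneg]
  have hc0 : (0 : ℝ) < c := lt_of_le_of_ne c.2 fun h => h0 (NNReal.coe_eq_zero.1 h.symm)
  have hexp : Real.exp (-(σ * x) ^ 2 / (2 * c)) ≤ Real.exp (-x ^ 2 / 2) := by
    refine Real.exp_le_exp.2 ?_
    rw [neg_div, neg_div, neg_le_neg_iff, div_le_div_iff₀ (by positivity) (by positivity)]
    nlinarith [sq_nonneg x]
  calc μ.real {ω | σ * x < |X ω|}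
      ≤ μ.real ({ω | σ * x ≤ X ω} ∪ {ω | σ * x ≤ (-X) ω}) := by
        refine measureReal_mono fun ω hω => ?_
        rcases lt_abs.1 (show σ * x < |X ω| from hω) with h | h
        · exact Or.inl h.le
        · exact Or.inr h.le
    _ ≤ _ := measureReal_union_le _ _
    _ ≤ Real.exp (-(σ * x) ^ 2 / (2 * c)) + Real.exp (-(σ * x) ^ 2 / (2 * c)) :=
        add_le_add (hX.measure_ge_le hε) (hX.neg.measure_ge_le hε)
    _ ≤ _ := by linarith

theorem measureReal_not_forall_abs_le (hindep : iIndepFun (fun t : Finset.Icc 1 n => Z t) μ)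
    (hZ : ∀ t ∈ Finset.Icc 1 n, HasSubgaussianMGF (Z t) (σ ^ 2) μ) {ι : Type*} (I : Finset ι)
    (T : ι → (ℕ → ℝ) → ℝ)
    (hT : ∀ i ∈ I, ∃ w : ℕ → ℝ, ∑ s ∈ Icc 1 n, w s ^ 2 ≤ 1 ∧
      ∀ z, T i z = ∑ s ∈ Icc 1 n, w s * z s) {x : ℝ} (hx : 0 ≤ x) :
    μ.real {ω | ¬ ∀ i ∈ I, |T i (fun s => Z s ω)| ≤ σ * x} ≤
      I.card * (2 * Real.exp (-x ^ 2 / 2)) := by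
  have h : {ω | ¬ ∀ i ∈ I, |T i (fun s => Z s ω)| ≤ σ * x} =
      ⋃ i ∈ I, {ω | σ * x < |T i (fun s => Z s ω)|} := by
    ext ω; simp
  rw [h]
  refine (measureReal_biUnion_finset_le _ _).trans ?_
  rw [← nsmul_eq_mul, ← sum_const]
  refine sum_le_sum fun i hi => ?_
  obtain ⟨w, hw, hwT⟩ := hT i hi
  simp only [hwT]
  exact measureReal_lt_abs_sum_le hindep hZ hw hx

theorem exists_sum_Icc_eq_sum {a b : ℕ} (ha : 1 ≤ a) (hab : a ≤ b) (hb : b ≤ n) :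
    ∃ w : ℕ → ℝ, ∑ s ∈ Icc 1 n, w s ^ 2 ≤ 1 ∧ ∀ z : ℕ → ℝ,
      (∑ s ∈ Icc a b, z s) / Real.sqrt ((b + 1 - a : ℕ) : ℝ) = ∑ s ∈ Icc 1 n, w s * z s := by
  have hL : (0 : ℝ) < ((b + 1 - a : ℕ) : ℝ) := by
    have : 0 < b + 1 - a := by omega
    exact_mod_cast this
  have hext : ∀ g : ℕ → ℝ, ∑ s ∈ Icc 1 n, (if s ∈ Icc a b then g s else 0) = ∑ s ∈ Icc a b, g s := by
    intro g
    rw [← sum_filter]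
    refine sum_congr ?_ fun _ _ => rfl
    ext s
    simp only [mem_filter, mem_Icc]; omega
  refine ⟨fun s => if s ∈ Icc a b then 1 / Real.sqrt ((b + 1 - a : ℕ) : ℝ) else 0, ?_, fun z => ?_⟩
  · simp only [ite_pow, ne_eq, OfNat.ofNat_ne_zero, not_false_eq_true, zero_pow]
    rw [hext fun _ => _, sum_const, Nat.card_Icc, nsmul_eq_mul, div_pow, Real.sq_sqrt hL.le]
    rw [one_pow, mul_one_div_cancel hL.ne']
  · simp only [ite_mul, zero_mul]
    rw [hext fun s => 1 / Real.sqrt ((b + 1 - a : ℕ) : ℝ) * z s, ← mul_sum]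
    ring

/-- The noise sequences for which all Haar coefficients and all normalized interval sums
are bounded by `lam`. -/
def GoodNoise (n : ℕ) (lam : ℝ) (z : ℕ → ℝ) : Prop :=
  (∀ a b, 1 ≤ a → a ≤ b → b ≤ n → ∀ l < padExp a b, ∀ i < 2 ^ l,
    |haarCoef (2 ^ (padExp a b - l - 1)) (padSeq z a b) i| ≤ lam) ∧
  ∀ a b, 1 ≤ a → a ≤ b → b ≤ n →
    |∑ s ∈ Icc a b, z s| ≤ lam * Real.sqrt ((b + 1 - a : ℕ) : ℝ)

theorem measureReal_goodNoise (hn : 2 ≤ n) {δ : ℝ} (hδ : 0 < δ) (hδ1 : δ ≤ 1)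
    (hindep : iIndepFun (fun t : Finset.Icc 1 n => Z t) μ)
    (hZ : ∀ t ∈ Finset.Icc 1 n, HasSubgaussianMGF (Z t) (σ ^ 2) μ) :
    1 - δ ≤ μ.real {ω | GoodNoise n
      (σ * Real.sqrt ((24 + 8 * Real.log (8 / δ) / Real.log n) * Real.log n))
      (fun s => Z s ω)} := by
  have hn' : (2 : ℝ) ≤ n := by exact_mod_cast hn
  have hlog : 0 < Real.log n := Real.log_pos (by linarith)
  have hlog8 : 0 < Real.log (8 / δ) := Real.log_pos (by rw [lt_div_iff₀ hδ]; linarith)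
  set x := Real.sqrt ((24 + 8 * Real.log (8 / δ) / Real.log n) * Real.log n) with hx
  have hx0 : 0 ≤ x := Real.sqrt_nonneg _
  -- Here the choice of `β` enters: `x² = 24 log n + 8 log (8 / δ)`, which leaves ample room for a
  -- union over `O(n⁴)` events.
  have hexp : Real.exp (-x ^ 2 / 2) = (δ / 8) ^ 4 / n ^ 12 := by
    have e : -x ^ 2 / 2 = ((4 : ℕ) : ℝ) * Real.log (δ / 8) - ((12 : ℕ) : ℝ) * Real.log n := by
      rw [hx, Real.sq_sqrt (by positivity), Real.log_div (by norm_num) hδ.ne',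
        Real.log_div hδ.ne' (by norm_num)]
      field_simp
      push_cast
      ring
    rw [e, Real.exp_sub, Real.exp_nat_mul, Real.exp_nat_mul, Real.exp_log (by positivity),
      Real.exp_log (by positivity)]
  -- The bound `2 * n` for level and position comes from `l < 2 ^ l` and `i < 2 ^ l ≤ 2 ^ padExp a b
  -- ≤ 2 * (b + 1 - a)`.
  set I : Finset (ℕ × ℕ × ℕ × ℕ) :=
    (range (n + 1) ×ˢ range (n + 1) ×ˢ range (2 * n) ×ˢ range (2 * n)).filter fun q =>
      1 ≤ q.1 ∧ q.1 ≤ q.2.1 ∧ q.2.1 ≤ n ∧ q.2.2.1 < padExp q.1 q.2.1 ∧ q.2.2.2 < 2 ^ q.2.2.1 with hI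
  set I' : Finset (ℕ × ℕ) :=
    (range (n + 1) ×ˢ range (n + 1)).filter fun q => 1 ≤ q.1 ∧ q.1 ≤ q.2 ∧ q.2 ≤ n with hI'
  have hcard : (I.card : ℝ) ≤ 9 * n ^ 4 := by
    have : I.card ≤ (n + 1) * ((n + 1) * (2 * n * (2 * n))) := by
      refine (card_filter_le _ _).trans ?_
      simp
    have h2 : (I.card : ℝ) ≤ (n + 1) * ((n + 1) * (2 * n * (2 * n))) := by exact_mod_cast this
    have h3 : ((n : ℝ) + 1) ^ 2 ≤ 9 / 4 * n ^ 2 := by nlinarith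
    nlinarith [mul_le_mul_of_nonneg_right h3 (show (0 : ℝ) ≤ 4 * n ^ 2 by positivity)]
  have hcard' : (I'.card : ℝ) ≤ 9 * n ^ 4 := by
    have : I'.card ≤ (n + 1) * (n + 1) := by
      refine (card_filter_le _ _).trans ?_
      simp
    have h2 : (I'.card : ℝ) ≤ (n + 1) * (n + 1) := by exact_mod_cast this
    have h3 : ((n : ℝ) + 1) ^ 2 ≤ 9 / 4 * n ^ 2 := by nlinarith
    have h4 : (1 : ℝ) ≤ n ^ 2 := one_le_pow₀ (by linarith)
    nlinarith
  have h1 := measureReal_not_forall_abs_le hindep hZ I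
    (fun q z => haarCoef (2 ^ (padExp q.1 q.2.1 - q.2.2.1 - 1)) (padSeq z q.1 q.2.1) q.2.2.2)
    (fun q hq => by
      obtain ⟨_, h1, h2, h3, h4, h5⟩ := mem_filter.1 hq
      exact exists_haarCoef_padSeq_eq_sum h1 h2 h3 h4 h5) hx0
  have h2 := measureReal_not_forall_abs_le hindep hZ I'
    (fun q z => (∑ s ∈ Icc q.1 q.2, z s) / Real.sqrt ((q.2 + 1 - q.1 : ℕ) : ℝ))
    (fun q hq => by
      obtain ⟨_, h1, h2, h3⟩ := mem_filter.1 hq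
      exact exists_sum_Icc_eq_sum h1 h2 h3) hx0
  set E1 := {ω | ¬ ∀ q ∈ I, |haarCoef (2 ^ (padExp q.1 q.2.1 - q.2.2.1 - 1))
    (padSeq (fun s => Z s ω) q.1 q.2.1) q.2.2.2| ≤ σ * x} with hE1
  set E2 := {ω | ¬ ∀ q ∈ I', |(∑ s ∈ Icc q.1 q.2, Z s ω) /
    Real.sqrt ((q.2 + 1 - q.1 : ℕ) : ℝ)| ≤ σ * x} with hE2
  set G := {ω | GoodNoise n (σ * x) (fun s => Z s ω)} with hG
  have hsub : (Set.univ : Set Ω) ⊆ G ∪ (E1 ∪ E2) := by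
    intro ω _
    by_contra hω
    simp only [Set.mem_union, not_or, hE1, hE2, Set.mem_ofPred_eq, not_not] at hω
    obtain ⟨hω, hω1, hω2⟩ := hω
    refine hω ⟨fun a b ha hab hb l hl i hi => ?_, fun a b ha hab hb => ?_⟩
    · refine hω1 (a, b, l, i) (mem_filter.2 ⟨?_, ha, hab, hb, hl, hi⟩)
      have h3 := two_pow_padExp_le hab
      have h4 : l < 2 ^ l := Nat.lt_two_pow_self
      have h5 : 2 ^ l ≤ 2 ^ padExp a b := Nat.pow_le_pow_right (by norm_num) hl.le
      simp only [mem_product, mem_range]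
      omega
    · have h3 := hω2 (a, b) (mem_filter.2 ⟨by simp only [mem_product, mem_range]; omega, ha, hab, hb⟩)
      have hL : (0 : ℝ) < Real.sqrt ((b + 1 - a : ℕ) : ℝ) := by
        have : 0 < b + 1 - a := by omega
        exact Real.sqrt_pos.2 (by exact_mod_cast this)
      rwa [abs_div, abs_of_pos hL, div_le_iff₀ hL] at h3
  have hone : (1 : ℝ) ≤ μ.real G + (μ.real E1 + μ.real E2) := by
    calc (1 : ℝ) = μ.real Set.univ := by simp
      _ ≤ μ.real (G ∪ (E1 ∪ E2)) := measureReal_mono hsub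
      _ ≤ μ.real G + μ.real (E1 ∪ E2) := measureReal_union_le _ _
      _ ≤ _ := by gcongr; exact measureReal_union_le _ _
  have hsmall : 9 * (n : ℝ) ^ 4 * (2 * Real.exp (-x ^ 2 / 2)) ≤ δ / 2 := by
    rw [hexp]
    have h3 : (δ / 8) ^ 4 ≤ δ / 4096 := by
      have : δ ^ 4 ≤ δ := by
        simpa using pow_le_pow_of_le_one hδ.le hδ1 (show 1 ≤ 4 by norm_num)
      rw [div_pow]; linarith
    have h4 : (n : ℝ) ^ 4 ≤ n ^ 12 := pow_le_pow_right₀ (by linarith) (by norm_num)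
    have hp : (0 : ℝ) < n ^ 12 := by positivity
    rw [show 9 * (n : ℝ) ^ 4 * (2 * ((δ / 8) ^ 4 / n ^ 12)) =
      18 * (n ^ 4 * (δ / 8) ^ 4) / n ^ 12 by ring, div_le_iff₀ hp]
    have h5 : (n : ℝ) ^ 4 * (δ / 8) ^ 4 ≤ n ^ 12 * (δ / 4096) :=
      mul_le_mul h4 h3 (by positivity) hp.le
    nlinarith [mul_pos hδ hp]
  have hpos : 0 ≤ 2 * Real.exp (-x ^ 2 / 2) := by positivity
  have h3 := mul_le_mul_of_nonneg_right hcard hpos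
  have h4 := mul_le_mul_of_nonneg_right hcard' hpos
  linarith

end Probability

/-! ### The error within a bin -/

/-- The jump of `θ` at time `t`, where `θ 1` counts as no jump. -/
noncomputable def jump (θ : ℕ → ℝ) (t : ℕ) : ℝ := if 2 ≤ t then |θ t - θ (t - 1)| else 0

theorem jump_nonneg (θ : ℕ → ℝ) (t : ℕ) : 0 ≤ jump θ t := by
  unfold jump
  split_ifs
  · exact abs_nonneg _
  · exact le_rfl

theorem variation_le_sum_jump (θ : ℕ → ℝ) {h b e : ℕ} (hh : 1 ≤ h) (hb : b ≤ e) :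
    ∑ u ∈ Ico h b, |θ (u + 1) - θ u| ≤ ∑ t ∈ Icc h e, jump θ t := by
  have h1 : ∑ u ∈ Ico h b, |θ (u + 1) - θ u| = ∑ t ∈ Ico (h + 1) (b + 1), jump θ t := by
    rw [← sum_Ico_add' (fun t => jump θ t) h b 1]
    refine sum_congr rfl fun u hu => ?_
    rw [jump, if_pos (by have := (mem_Ico.1 hu).1; omega), Nat.add_sub_cancel]
  rw [h1]
  refine sum_le_sum_of_subset_of_nonneg (fun t ht => ?_) fun _ _ _ => jump_nonneg θ _
  rw [mem_Ico] at ht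
  rw [mem_Icc]; omega

theorem sum_jump_eq (θ : ℕ → ℝ) (n : ℕ) (hn : 1 ≤ n) :
    ∑ t ∈ Icc 1 n, jump θ t = ∑ t ∈ Ico 1 n, |θ (t + 1) - θ t| := by
  have h1 : ∑ u ∈ Ico 1 n, |θ (u + 1) - θ u| = ∑ t ∈ Ico (1 + 1) (n + 1), jump θ t := by
    rw [← sum_Ico_add' (fun t => jump θ t) 1 n 1]
    refine sum_congr rfl fun u hu => ?_
    rw [jump, if_pos (by have := (mem_Ico.1 hu).1; omega), Nat.add_sub_cancel]
  rw [h1, ← add_sum_Ioc_eq_sum_Icc hn, show jump θ 1 = 0 by simp [jump], zero_add]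
  rfl

theorem sum_Ioc_one_div_sub_le {h e n : ℕ} (hen : e ≤ n) :
    ∑ t ∈ Ioc h e, (1 : ℝ) / ((t - h : ℕ) : ℝ) ≤ 1 + Real.log n := by
  rcases Nat.lt_or_ge h e with hlt | hge
  · have h1 : ∑ t ∈ Ioc h e, (1 : ℝ) / ((t - h : ℕ) : ℝ) = (harmonic (e - h) : ℝ) := by
      rw [show Ioc h e = Ico (h + 1) (e + 1) by ext; simp only [mem_Ioc, mem_Ico]; omega,
        sum_Ico_eq_sum_range, harmonic]
      push_cast
      refine sum_congr rfl fun i _ => ?_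
      rw [show h + 1 + i - h = i + 1 by omega, one_div]
      push_cast; ring
    rw [h1]
    refine (harmonic_le_one_add_log _).trans ?_
    have h2 : 0 < e - h := by omega
    have h3 : e - h ≤ n := by omega
    have := Real.log_le_log (by exact_mod_cast h2) (show ((e - h : ℕ) : ℝ) ≤ n by exact_mod_cast h3)
    linarith
  · rw [Ioc_eq_empty (by omega), sum_empty]
    have := Real.log_natCast_nonneg n
    linarith

section Bin

variable {n : ℕ} {σ β U : ℝ} {θ z : ℕ → ℝ} {h e : ℕ}

/-- The prediction `y (h - 1)` errs by one noise term, an interval sum of length one, and by the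
jump into the bin. That jump is charged to the new bin, which is why `jump` is indexed by its end
point. In the very first round the prediction is `0` and the error is at most `U`. -/
theorem sq_predict_start_le (hh : 1 ≤ h) (hn : h ≤ n) {lam : ℝ} (hz : GoodNoise n lam z)
    (hU : |θ 1| ≤ U) (hB : binStart n σ β (fun t => θ t + z t) h = h) :
    (predict n σ β (fun t => θ t + z t) h - θ h) ^ 2 ≤
      (if h = 1 then U ^ 2 else 0) + 2 * lam ^ 2 + 2 * jump θ h ^ 2 := by
  rw [predict, if_pos hB]
  rcases eq_or_ne h 1 with rfl | h1
  · simp only [if_true, zero_sub, neg_sq]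
    have : θ 1 ^ 2 ≤ U ^ 2 := sq_le_sq' (abs_le.1 hU).1 (abs_le.1 hU).2
    nlinarith [sq_nonneg lam, sq_nonneg (jump θ 1)]
  · rw [if_neg h1, if_neg h1, zero_add]
    have hz1 := hz.2 (h - 1) (h - 1) (by omega) le_rfl (by omega)
    rw [Icc_self, sum_singleton, show h - 1 + 1 - (h - 1) = 1 by omega] at hz1
    simp only [Nat.cast_one, Real.sqrt_one, mul_one] at hz1
    have hz2 : z (h - 1) ^ 2 ≤ lam ^ 2 := sq_le_sq' (abs_le.1 hz1).1 (abs_le.1 hz1).2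
    rw [jump, if_pos (by omega), sq_abs]
    nlinarith [sq_nonneg (z (h - 1) + (θ h - θ (h - 1)))]

theorem sq_avg_noise_le {lam : ℝ} (hz : GoodNoise n lam z) {t : ℕ} (hh : 1 ≤ h) (hht : h < t)
    (htn : t ≤ n) : avg z h (t - 1) ^ 2 ≤ lam ^ 2 * (1 / ((t - h : ℕ) : ℝ)) := by
  have h1 := hz.2 h (t - 1) hh (by omega) (by omega)
  have h2 := avg_mul_card z (show h ≤ t - 1 by omega)
  rw [← h2] at h1
  rw [show t - 1 + 1 - h = t - h by omega] at h1
  have hm : (0 : ℝ) < ((t - h : ℕ) : ℝ) := by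
    have : 0 < t - h := by omega
    exact_mod_cast this
  have h3 := sq_le_sq' (abs_le.1 h1).1 (abs_le.1 h1).2
  rw [mul_pow, mul_pow, Real.sq_sqrt hm.le] at h3
  rw [mul_one_div, le_div_iff₀ hm]
  have h4 : ((t - h : ℕ) : ℝ) * (avg z h (t - 1) ^ 2 * ((t - h : ℕ) : ℝ)) ≤
      ((t - h : ℕ) : ℝ) * lam ^ 2 := by linarith
  exact le_of_mul_le_mul_left h4 hm

/-- The logarithmic factor times the length and the variation of the bin `h, …, e`,
balanced as in the minimax rate. -/
noncomputable def binRate (n : ℕ) (θ : ℕ → ℝ) (h e : ℕ) : ℝ :=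
  padExp 1 n * ((2 * ((e + 1 - h : ℕ) : ℝ)) ^ (1 / 3 : ℝ) *
    (∑ t ∈ Icc h e, jump θ t) ^ (2 / 3 : ℝ))

/-- Replacing the logarithmic factor by `padExp 1 n` makes it independent of the bin, so it can be
pulled out of the sum over bins. -/
theorem rate_le_binRate (θ : ℕ → ℝ) {b : ℕ} (hh : 1 ≤ h) (hhb : h ≤ b) (hbe : b ≤ e)
    (hen : e ≤ n) :
    padExp h b * ((2 ^ padExp h b : ℝ) ^ (1 / 3 : ℝ) *
      (∑ u ∈ Ico h b, |θ (u + 1) - θ u|) ^ (2 / 3 : ℝ)) ≤ binRate n θ h e := by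
  have hJ : padExp h b ≤ padExp 1 n := Nat.clog_mono_right 2 (by omega)
  have hk : (2 : ℝ) ^ padExp h b ≤ 2 * ((e + 1 - h : ℕ) : ℝ) := by
    have h1 := two_pow_padExp_le hhb
    have h2 : 2 ^ padExp h b ≤ 2 * (e + 1 - h) := by omega
    exact_mod_cast h2
  have hV := variation_le_sum_jump θ hh hbe
  have hV0 : 0 ≤ ∑ u ∈ Ico h b, |θ (u + 1) - θ u| := sum_nonneg fun _ _ => abs_nonneg _
  unfold binRate
  have hJ' : (padExp h b : ℝ) ≤ padExp 1 n := by exact_mod_cast hJ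
  have h3 := Real.rpow_le_rpow (by positivity) hk (show (0 : ℝ) ≤ 1 / 3 by norm_num)
  have h4 := Real.rpow_le_rpow hV0 hV (show (0 : ℝ) ≤ 2 / 3 by norm_num)
  exact mul_le_mul hJ' (mul_le_mul h3 h4 (by positivity) (by positivity)) (by positivity)
    (by positivity)

theorem binRate_nonneg (θ : ℕ → ℝ) (h e : ℕ) : 0 ≤ binRate n θ h e := by
  have : 0 ≤ ∑ t ∈ Icc h e, jump θ t := sum_nonneg fun _ _ => jump_nonneg θ _
  unfold binRate
  positivity

theorem sum_sq_bias_le (hh : 1 ≤ h) (hen : e ≤ n)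
    (hz : GoodNoise n (σ * Real.sqrt (β * Real.log n)) z)
    (hr : ∀ t, h ≤ t → t < e → ¬ Restart n σ β (fun t => θ t + z t) h t) :
    ∑ t ∈ Ioc h e, (θ t - avg θ h (t - 1)) ^ 2 ≤ 8 * σ ^ 2 +
      2 * (4 * (σ * Real.sqrt (β * Real.log n))) ^ (4 / 3 : ℝ) * binRate n θ h e +
      (∑ t ∈ Icc h e, jump θ t) ^ 2 := by
  have hlam : h ≤ n → 0 ≤ σ * Real.sqrt (β * Real.log n) := fun hhn => by
    have := hz.2 h h hh le_rfl hhn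
    rw [show h + 1 - h = 1 by omega] at this
    simp only [Nat.cast_one, Real.sqrt_one, mul_one] at this
    exact (abs_nonneg _).trans this
  set lam := σ * Real.sqrt (β * Real.log n)
  rcases Nat.lt_or_ge h e with hlt | hge
  · obtain ⟨b, rfl⟩ : ∃ b, e = b + 1 := ⟨e - 1, by omega⟩
    have hhb : h ≤ b := by omega
    -- A restart may occur at the end `b + 1` of the bin, so the variance bound is available only up
    -- to `b`. The last round is bounded directly by the variation.
    rw [sum_Ioc_succ_top hhb, Nat.add_sub_cancel]
    have h1 := sum_sq_sub_running_avg_le θ hhb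
    have h2 := sum_sq_sub_avg_le_of_not_restart (θ := θ) hhb
      (fun l hl i hi => hz.1 h b hh hhb (by omega) l hl i hi) (hr b hhb (by omega))
    have h3 := mul_le_mul_of_nonneg_left (rate_le_binRate θ hh hhb (Nat.le_succ b) hen)
      (show 0 ≤ (4 * lam) ^ (4 / 3 : ℝ) by have := hlam (by omega); positivity)
    have h4 : |θ (b + 1) - avg θ h b| ≤ ∑ t ∈ Icc h (b + 1), jump θ t :=
      abs_sub_avg_le θ hhb fun s hs => by
        rw [mem_Icc] at hs
        exact (abs_sub_le_variation θ hs.1 (by omega) le_rfl).trans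
          (variation_le_sum_jump θ hh le_rfl)
    have h5 := sq_le_sq' (abs_le.1 h4).1 (abs_le.1 h4).2
    linarith
  · rw [Ioc_eq_empty (by omega), sum_empty]
    -- For `h > n` the good event does not give the sign of `lam`, but then the bin is empty and its
    -- rate vanishes.
    rcases Nat.lt_or_ge n h with hnh | hnh
    · have : e < h := by omega
      have h0 : binRate n θ h e = 0 := by
        unfold binRate
        rw [Icc_eq_empty (by omega), sum_empty, Real.zero_rpow (by norm_num)]
        ring
      rw [h0, mul_zero, add_zero]
      positivity
    · have := hlam hnh
      have := binRate_nonneg (n := n) θ h e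
      positivity

/-- After the first round the error is averaged noise plus bias, at the cost of a factor `2`. The
noise contributes `2 λ² (1 + log n)` by the harmonic sum, and the first round another `2 λ²`. -/
theorem sum_sq_bin_le (hh : 1 ≤ h) (hhe : h ≤ e) (hen : e ≤ n) (hU : |θ 1| ≤ U)
    (hz : GoodNoise n (σ * Real.sqrt (β * Real.log n)) z)
    (hB : ∀ t, h ≤ t → t ≤ e → binStart n σ β (fun t => θ t + z t) t = h)
    (hr : ∀ t, h ≤ t → t < e → ¬ Restart n σ β (fun t => θ t + z t) h t) :
    ∑ t ∈ Icc h e, (predict n σ β (fun t => θ t + z t) t - θ t) ^ 2 ≤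
      (if h = 1 then U ^ 2 else 0) + 4 * (∑ t ∈ Icc h e, jump θ t) ^ 2 +
      (4 + 2 * Real.log n) * (σ * Real.sqrt (β * Real.log n)) ^ 2 + 16 * σ ^ 2 +
      4 * (4 * (σ * Real.sqrt (β * Real.log n))) ^ (4 / 3 : ℝ) * binRate n θ h e := by
  have hbias := sum_sq_bias_le hh hen hz hr
  set lam := σ * Real.sqrt (β * Real.log n)
  have hstart := sq_predict_start_le hh (by omega) hz hU (hB h le_rfl hhe)
  have hjump : jump θ h ^ 2 ≤ (∑ t ∈ Icc h e, jump θ t) ^ 2 :=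
    pow_le_pow_left₀ (jump_nonneg θ h)
      (single_le_sum (f := jump θ) (fun t _ => jump_nonneg θ t) (mem_Icc.2 ⟨le_rfl, hhe⟩)) 2
  have hlater : ∑ t ∈ Ioc h e, (predict n σ β (fun t => θ t + z t) t - θ t) ^ 2 ≤
      ∑ t ∈ Ioc h e, (2 * lam ^ 2 * (1 / ((t - h : ℕ) : ℝ)) +
        2 * (θ t - avg θ h (t - 1)) ^ 2) := by
    refine sum_le_sum fun t ht => ?_
    rw [mem_Ioc] at ht
    rw [predict, hB t ht.1.le ht.2, if_neg (by omega), avg_add]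
    have := sq_avg_noise_le hz hh ht.1 (by omega)
    nlinarith [sq_nonneg (avg z h (t - 1) + (θ t - avg θ h (t - 1)))]
  rw [sum_add_distrib, ← mul_sum, ← mul_sum] at hlater
  have hharm := mul_le_mul_of_nonneg_left (sum_Ioc_one_div_sub_le (h := h) hen)
    (show 0 ≤ 2 * lam ^ 2 by positivity)
  rw [← add_sum_Ioc_eq_sum_Icc hhe]
  linarith

end Bin

/-! ### The bins -/

section Bins

variable {n : ℕ} {σ β : ℝ} {y : ℕ → ℝ}

theorem binStart_succ_of_restart {t : ℕ} (ht : 1 ≤ t)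
    (hr : Restart n σ β y (binStart n σ β y t) t) : binStart n σ β y (t + 1) = t + 1 := by
  obtain ⟨s, rfl⟩ := Nat.exists_eq_add_of_le' ht
  rw [binStart, if_pos hr]

theorem binStart_succ_of_not_restart {t : ℕ} (ht : 1 ≤ t)
    (hr : ¬ Restart n σ β y (binStart n σ β y t) t) :
    binStart n σ β y (t + 1) = binStart n σ β y t := by
  obtain ⟨s, rfl⟩ := Nat.exists_eq_add_of_le' ht
  rw [binStart, if_neg hr]

theorem binStart_spec {t : ℕ} (ht : 1 ≤ t) :
    1 ≤ binStart n σ β y t ∧ binStart n σ β y t ≤ t ∧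
      binStart n σ β y (binStart n σ β y t) = binStart n σ β y t := by
  induction t, ht using Nat.le_induction with
  | base => simp [binStart]
  | succ t ht ih =>
    by_cases hr : Restart n σ β y (binStart n σ β y t) t
    · rw [binStart_succ_of_restart ht hr]
      exact ⟨by omega, le_rfl, binStart_succ_of_restart ht hr⟩
    · rw [binStart_succ_of_not_restart ht hr]
      exact ⟨ih.1, by omega, ih.2.2⟩

theorem binStart_mono {s t : ℕ} (hs : 1 ≤ s) (hst : s ≤ t) :
    binStart n σ β y s ≤ binStart n σ β y t := by
  induction t, hst using Nat.le_induction with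
  | base => exact le_rfl
  | succ t hst ih =>
    by_cases hr : Restart n σ β y (binStart n σ β y t) t
    · rw [binStart_succ_of_restart (hs.trans hst) hr]
      have := (binStart_spec (n := n) (σ := σ) (β := β) (y := y) (hs.trans hst)).2.1
      omega
    · rwa [binStart_succ_of_not_restart (hs.trans hst) hr]

/-- Bin starts are nondecreasing and each start is its own bin start, so the fibres of `binStart`
are intervals. Only the bin containing round `n` can end without a restart. -/
theorem exists_bin_end {h : ℕ} (hS : h ∈ (Icc 1 n).image (binStart n σ β y)) :
    ∃ e, 1 ≤ h ∧ h ≤ e ∧ e ≤ n ∧ (Icc 1 n).filter (fun t => binStart n σ β y t = h) = Icc h e ∧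
      (∀ t, h ≤ t → t < e → ¬ Restart n σ β y h t) ∧
      (Restart n σ β y h e ∨ binStart n σ β y n = h) := by
  obtain ⟨s, hs, rfl⟩ := mem_image.1 hS
  set h := binStart n σ β y s with hh
  set F := (Icc 1 n).filter (fun t => binStart n σ β y t = h) with hF
  have hsF : s ∈ F := mem_filter.2 ⟨hs, rfl⟩
  obtain ⟨e, heF, hmax⟩ := F.exists_max_image id ⟨s, hsF⟩
  obtain ⟨he, heh⟩ := mem_filter.1 heF
  rw [mem_Icc] at hs he
  obtain ⟨h1, h2, h3⟩ := binStart_spec (n := n) (σ := σ) (β := β) (y := y) hs.1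
  have hse : s ≤ e := hmax s hsF
  have hconst : ∀ t, h ≤ t → t ≤ e → binStart n σ β y t = h := by
    intro t ht hte
    have h4 := binStart_mono (n := n) (σ := σ) (β := β) (y := y) h1 ht
    have h5 := binStart_mono (n := n) (σ := σ) (β := β) (y := y) (h1.trans ht) hte
    rw [h3] at h4
    rw [heh] at h5
    exact le_antisymm h5 h4
  refine ⟨e, h1, h2.trans hse, he.2, ?_, ?_, ?_⟩
  · ext t
    rw [hF, mem_filter, mem_Icc, mem_Icc]
    constructor
    · rintro ⟨ht, hth⟩
      refine ⟨?_, hmax t (mem_filter.2 ⟨mem_Icc.2 ht, hth⟩)⟩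
      rw [← hth]
      exact (binStart_spec ht.1).2.1
    · rintro ⟨ht, hte⟩
      exact ⟨⟨h1.trans ht, hte.trans he.2⟩, hconst t ht hte⟩
  · intro t ht hte hr
    rw [← hconst t ht hte.le] at hr
    have h4 := binStart_succ_of_restart (h1.trans ht) hr
    rw [hconst (t + 1) (by omega) hte] at h4
    omega
  · by_contra hcon
    rw [not_or] at hcon
    obtain ⟨hr, hn⟩ := hcon
    rcases Nat.lt_or_ge e n with hen | hen
    · rw [← heh] at hr
      have h4 := binStart_succ_of_not_restart he.1 hr
      have h5 : e + 1 ≤ e :=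
        hmax (e + 1) (mem_filter.2 ⟨mem_Icc.2 ⟨by omega, hen⟩, h4.trans heh⟩)
      omega
    · obtain rfl : e = n := by omega
      exact hn heh

end Bins

/-- The total squared error on the event that the noise is well behaved. -/
theorem sum_sq_predict_sub_le {n : ℕ} (hn : 1 ≤ n) {σ β U C : ℝ} {θ z : ℕ → ℝ} (hσ : 0 ≤ σ)
    (hβ : 0 ≤ β * Real.log n) (hC : θ ∈ TVClass n C) (hU : |θ 1| ≤ U)
    (hz : GoodNoise n (σ * Real.sqrt (β * Real.log n)) z) :
    ∑ t ∈ Icc 1 n, (predict n σ β (fun t => θ t + z t) t - θ t) ^ 2 ≤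
      U ^ 2 + 4 * C ^ 2 + ((4 + 2 * Real.log n) * (β * Real.log n) + 16) * σ ^ 2 +
      (((4 + 2 * Real.log n) * (β * Real.log n) + 16) * σ ^ (4 / 3 : ℝ) +
        4 * (4 * (σ * Real.sqrt (β * Real.log n))) ^ (4 / 3 : ℝ)) *
      (padExp 1 n * ((2 * (n : ℝ)) ^ (1 / 3 : ℝ) * C ^ (2 / 3 : ℝ))) := by
  set y : ℕ → ℝ := fun t => θ t + z t with hy
  set S := (Icc 1 n).image (binStart n σ β y) with hS
  choose! e h1 he hen hF hr hlast using fun h (hS : h ∈ S) => exists_bin_end hS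
  have hfib : ∀ g : ℕ → ℝ, ∑ t ∈ Icc 1 n, g t = ∑ h ∈ S, ∑ t ∈ Icc h (e h), g t := by
    intro g
    rw [← sum_fiberwise_of_maps_to (fun t ht => mem_image_of_mem (binStart n σ β y) ht)]
    exact sum_congr rfl fun h hh => by rw [hF h hh]
  set Q := (4 + 2 * Real.log n) * (β * Real.log n) + 16 with hQ
  have hlogn := Real.log_natCast_nonneg n
  have hQ0 : 0 ≤ Q := by positivity
  set V : ℕ → ℝ := fun h => ∑ t ∈ Icc h (e h), jump θ t with hV
  have hV0 : ∀ h, 0 ≤ V h := fun h => sum_nonneg fun _ _ => jump_nonneg θ _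
  have hVsum : ∑ h ∈ S, V h ≤ C := by
    rw [← hfib, sum_jump_eq θ n hn]; exact hC
  have hVsq : ∑ h ∈ S, V h ^ 2 ≤ C ^ 2 :=
    (sum_sq_le_sq_sum_of_nonneg fun h _ => hV0 h).trans
      (pow_le_pow_left₀ (sum_nonneg fun h _ => hV0 h) hVsum 2)
  have hLsum : ∑ h ∈ S, 2 * ((e h + 1 - h : ℕ) : ℝ) = 2 * n := by
    have := hfib fun _ => 1
    simp only [sum_const, Nat.card_Icc, nsmul_eq_mul, mul_one, Nat.add_sub_cancel] at this
    rw [← mul_sum, this]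
  have hrate : ∑ h ∈ S, binRate n θ h (e h) ≤
      padExp 1 n * ((2 * (n : ℝ)) ^ (1 / 3 : ℝ) * C ^ (2 / 3 : ℝ)) := by
    unfold binRate
    rw [← mul_sum]
    refine mul_le_mul_of_nonneg_left ?_ (by positivity)
    refine (sum_rpow_third_mul_le S _ V (fun h _ => by positivity) fun h _ => hV0 h).trans ?_
    rw [hLsum]
    exact mul_le_mul_of_nonneg_left
      (Real.rpow_le_rpow (sum_nonneg fun h _ => hV0 h) hVsum (by norm_num)) (by positivity)
  -- A bin closed by a restart charges its `σ²` to its own variation; only the bin of round `n` may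
  -- have to pay it outright.
  have hσbin : ∀ h ∈ S, σ ^ 2 ≤ σ ^ (4 / 3 : ℝ) * binRate n θ h (e h) +
      if h = binStart n σ β y n then σ ^ 2 else 0 := by
    intro h hh
    have hb := binRate_nonneg (n := n) θ h (e h)
    rcases hlast h hh with hl | hl
    · have h2 := sq_le_variation_of_restart hσ (he h hh)
        (fun l hl i hi => hz.1 h (e h) (h1 h hh) (he h hh) (hen h hh) l hl i hi) hl
      have h3 := mul_le_mul_of_nonneg_left
        (rate_le_binRate θ (h1 h hh) (he h hh) le_rfl (hen h hh))
        (show 0 ≤ σ ^ (4 / 3 : ℝ) by positivity)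
      have h4 : (0 : ℝ) ≤ if h = binStart n σ β y n then σ ^ 2 else 0 := by
        split_ifs <;> positivity
      linarith
    · rw [if_pos hl.symm]
      have : 0 ≤ σ ^ (4 / 3 : ℝ) * binRate n θ h (e h) := by positivity
      linarith
  have hbin : ∀ h ∈ S, ∑ t ∈ Icc h (e h), (predict n σ β y t - θ t) ^ 2 ≤
      (if h = 1 then U ^ 2 else 0) + 4 * V h ^ 2 +
      Q * (if h = binStart n σ β y n then σ ^ 2 else 0) +
      (Q * σ ^ (4 / 3 : ℝ) + 4 * (4 * (σ * Real.sqrt (β * Real.log n))) ^ (4 / 3 : ℝ)) *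
        binRate n θ h (e h) := by
    intro h hh
    have hmem : ∀ t, h ≤ t → t ≤ e h → binStart n σ β y t = h := by
      intro t ht hte
      have : t ∈ (Icc 1 n).filter fun t => binStart n σ β y t = h := by
        rw [hF h hh]; exact mem_Icc.2 ⟨ht, hte⟩
      exact (mem_filter.1 this).2
    have h2 := sum_sq_bin_le (h1 h hh) (he h hh) (hen h hh) hU hz hmem (hr h hh)
    have h3 := mul_le_mul_of_nonneg_left (hσbin h hh) hQ0
    have h4 : (4 + 2 * Real.log n) * (σ * Real.sqrt (β * Real.log n)) ^ 2 + 16 * σ ^ 2 =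
        Q * σ ^ 2 := by
      rw [mul_pow, Real.sq_sqrt hβ, hQ]; ring
    linarith
  have hU2 : ∑ h ∈ S, (if h = 1 then U ^ 2 else 0) ≤ U ^ 2 := by
    rw [sum_ite_eq']
    split_ifs
    · exact le_rfl
    · positivity
  have hσ2 : ∑ h ∈ S, (if h = binStart n σ β y n then σ ^ 2 else 0) ≤ σ ^ 2 := by
    rw [sum_ite_eq']
    split_ifs
    · exact le_rfl
    · positivity
  rw [hfib]
  refine (sum_le_sum hbin).trans ?_
  rw [sum_add_distrib, sum_add_distrib, sum_add_distrib, ← mul_sum, ← mul_sum, ← mul_sum]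
  have h5 := mul_le_mul_of_nonneg_left hσ2 hQ0
  have h6 := mul_le_mul_of_nonneg_left hrate (show 0 ≤ Q * σ ^ (4 / 3 : ℝ) +
    4 * (4 * (σ * Real.sqrt (β * Real.log n))) ^ (4 / 3 : ℝ) by positivity)
  linarith

/-! ### The regret bound -/

theorem dynamicRegret_quadLoss (n : ℕ) (θ x : ℕ → ℝ) :
    dynamicRegret n (quadLoss θ) x = ∑ t ∈ Icc 1 n, (x t - θ t) ^ 2 := by
  have h : ∀ t, ⨅ u : ℝ, quadLoss θ t u = 0 := fun t => by
    refine le_antisymm ?_ (Real.iInf_nonneg fun u => sq_nonneg _)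
    refine (ciInf_le ⟨0, ?_⟩ (θ t)).trans (by simp [quadLoss])
    rintro _ ⟨u, rfl⟩
    exact sq_nonneg _
  rw [dynamicRegret, sum_congr rfl fun t _ => h t, sum_const_zero, sub_zero]
  rfl

theorem padExp_one_le {n : ℕ} (hn : 2 ≤ n) : (padExp 1 n : ℝ) ≤ 1 + 2 * Real.log n := by
  unfold padExp
  rw [Nat.add_sub_cancel]
  have h1 := Nat.pow_pred_clog_lt_self (b := 2) (by norm_num) (show 1 < n by omega)
  have h2 : 0 < Nat.clog 2 n := Nat.clog_pos (by norm_num) hn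
  obtain ⟨k, hk⟩ := Nat.exists_eq_succ_of_ne_zero h2.ne'
  rw [hk] at h1 ⊢
  rw [Nat.pred_succ] at h1
  have h3 : (2 : ℝ) ^ k ≤ n := by exact_mod_cast h1.le
  have h4 := Real.log_le_log (by positivity) h3
  rw [Real.log_pow] at h4
  have h5 := Real.log_two_gt_d9
  have h6 : (0 : ℝ) ≤ k := Nat.cast_nonneg k
  push_cast
  nlinarith

theorem polylog_bound {n : ℕ} (hn : 2 ≤ n) {σ δ U C : ℝ} (hσ : 0 ≤ σ) (hδ : 0 < δ) (hδ1 : δ ≤ 1)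
    (hC : 0 ≤ C) {ρ : ℝ} (hρ : ρ = 24 * Real.log n + 8 * Real.log (8 / δ)) :
    U ^ 2 + 4 * C ^ 2 + ((4 + 2 * Real.log n) * ρ + 16) * σ ^ 2 +
      (((4 + 2 * Real.log n) * ρ + 16) * σ ^ (4 / 3 : ℝ) +
        4 * (4 * (σ * Real.sqrt ρ)) ^ (4 / 3 : ℝ)) *
      (padExp 1 n * ((2 * (n : ℝ)) ^ (1 / 3 : ℝ) * C ^ (2 / 3 : ℝ))) ≤
    6592 * (1 + Real.log n + Real.log (1 / δ)) ^ 3 *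
      ((n : ℝ) ^ (1 / 3 : ℝ) * C ^ (2 / 3 : ℝ) * σ ^ (4 / 3 : ℝ) + U ^ 2 + C ^ 2 + σ ^ 2) := by
  set Λ := 1 + Real.log n + Real.log (1 / δ) with hΛ
  have hn' : (2 : ℝ) ≤ n := by exact_mod_cast hn
  have hd : 0 ≤ Real.log (1 / δ) := Real.log_nonneg (by rw [le_div_iff₀ hδ]; linarith)
  have hl2 := Real.log_two_gt_d9
  have hl2' := Real.log_two_lt_d9
  have hlog2 : Real.log 2 ≤ Real.log n := Real.log_le_log (by norm_num) hn'
  have h8 : Real.log (8 / δ) = 3 * Real.log 2 + Real.log (1 / δ) := by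
    rw [show 8 / δ = 2 ^ 3 * (1 / δ) by ring, Real.log_mul (by norm_num) (by positivity),
      Real.log_pow]
    norm_num
  have hρ1 : 1 ≤ ρ := by rw [hρ, h8]; linarith
  have hρ2 : ρ ≤ 24 * Λ := by rw [hρ, h8, hΛ]; linarith
  have hΛ1 : 1 ≤ Λ := by linarith
  have hΛ12 : Λ ≤ Λ ^ 2 := by nlinarith
  have hΛ23 : Λ ^ 2 ≤ Λ ^ 3 := pow_le_pow_right₀ hΛ1 (by norm_num)
  set Q := (4 + 2 * Real.log n) * ρ + 16 with hQdef
  have hQ : Q ≤ 112 * Λ ^ 2 := by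
    have : (4 + 2 * Real.log n) * ρ ≤ (4 * Λ) * (24 * Λ) :=
      mul_le_mul (by linarith) hρ2 (by linarith) (by linarith)
    nlinarith
  -- The power of `16 ρ ≥ 1` is `2/3`, rounded up to `1`; then `16 * 24 = 384`.
  have hlam : (4 * (σ * Real.sqrt ρ)) ^ (4 / 3 : ℝ) ≤ 384 * Λ ^ 2 * σ ^ (4 / 3 : ℝ) := by
    have e : 4 * (σ * Real.sqrt ρ) = Real.sqrt (16 * ρ) * σ := by
      rw [Real.sqrt_mul (by norm_num), show (16 : ℝ) = 4 ^ 2 by norm_num,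
        Real.sqrt_sq (by norm_num)]
      ring
    rw [e, Real.mul_rpow (Real.sqrt_nonneg _) hσ, Real.sqrt_eq_rpow,
      ← Real.rpow_mul (by linarith)]
    refine mul_le_mul_of_nonneg_right ?_ (by positivity)
    calc (16 * ρ) ^ (1 / 2 * (4 / 3) : ℝ) ≤ (16 * ρ) ^ (1 : ℝ) :=
          Real.rpow_le_rpow_of_exponent_le (by linarith) (by norm_num)
      _ = 16 * ρ := Real.rpow_one _
      _ ≤ _ := by linarith
  have hJ : (padExp 1 n : ℝ) ≤ 2 * Λ := (padExp_one_le hn).trans (by linarith)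
  have h2n : (2 * (n : ℝ)) ^ (1 / 3 : ℝ) ≤ 2 * (n : ℝ) ^ (1 / 3 : ℝ) := by
    rw [Real.mul_rpow (by norm_num) (by positivity)]
    refine mul_le_mul_of_nonneg_right ?_ (by positivity)
    calc (2 : ℝ) ^ (1 / 3 : ℝ) ≤ 2 ^ (1 : ℝ) :=
          Real.rpow_le_rpow_of_exponent_le (by norm_num) (by norm_num)
      _ = 2 := Real.rpow_one _
  have hs : 0 ≤ σ ^ (4 / 3 : ℝ) := by positivity
  have hc : 0 ≤ C ^ (2 / 3 : ℝ) := by positivity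
  -- The constants are `1648 = 112 + 4 * 384` and finally `6592 = 4 * 1648`. The cube consists of
  -- `Λ²` from noise and threshold and one `Λ` from the number of levels.
  have hmain : (Q * σ ^ (4 / 3 : ℝ) + 4 * (4 * (σ * Real.sqrt ρ)) ^ (4 / 3 : ℝ)) *
      (padExp 1 n * ((2 * (n : ℝ)) ^ (1 / 3 : ℝ) * C ^ (2 / 3 : ℝ))) ≤
      (1648 * Λ ^ 2 * σ ^ (4 / 3 : ℝ)) *
        (2 * Λ * (2 * (n : ℝ) ^ (1 / 3 : ℝ) * C ^ (2 / 3 : ℝ))) := by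
    refine mul_le_mul ?_ ?_ (by positivity) (by positivity)
    · have := mul_le_mul_of_nonneg_right hQ hs
      linarith
    · exact mul_le_mul hJ (mul_le_mul_of_nonneg_right h2n hc) (by positivity) (by positivity)
  have h1 : Q * σ ^ 2 ≤ 6592 * Λ ^ 3 * σ ^ 2 :=
    mul_le_mul_of_nonneg_right (by linarith) (sq_nonneg σ)
  have h2 : U ^ 2 ≤ 6592 * Λ ^ 3 * U ^ 2 := le_mul_of_one_le_left (sq_nonneg U) (by linarith)
  have h3 : 4 * C ^ 2 ≤ 6592 * Λ ^ 3 * C ^ 2 :=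
    mul_le_mul_of_nonneg_right (by linarith) (sq_nonneg C)
  linarith

end Arrows

theorem corollary1 :
    ∃ K : ℝ, 0 < K ∧ ∃ p : ℕ,
      ∀ (Ω : Type*) [MeasurableSpace Ω] (μ : MeasureTheory.Measure Ω)
        [MeasureTheory.IsProbabilityMeasure μ]
        (n : ℕ) (σ : NNReal) (δ C U : ℝ) (θ : ℕ → ℝ) (Z : ℕ → Ω → ℝ),
        2 ≤ n → 0 < δ → δ ≤ 1 →
        ProbabilityTheory.iIndepFun (fun t : Finset.Icc 1 n => Z t) μ →
        (∀ t ∈ Finset.Icc 1 n, ProbabilityTheory.HasSubgaussianMGF (Z t) (σ ^ 2) μ) →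
        θ ∈ Arrows.TVClass n C →
        |θ 1| ≤ U →
        1 - δ ≤ μ.real {ω |
          Arrows.dynamicRegret n (Arrows.quadLoss θ)
            (Arrows.predict n σ (24 + 8 * Real.log (8 / δ) / Real.log n)
              (fun t => θ t + Z t ω)) ≤
          K * (1 + Real.log n + Real.log (1 / δ)) ^ p *
            ((n : ℝ) ^ (1 / 3 : ℝ) * C ^ (2 / 3 : ℝ) * (σ : ℝ) ^ (4 / 3 : ℝ)
              + U ^ 2 + C ^ 2 + (σ : ℝ) ^ 2)} := by
  refine ⟨6592, by norm_num, 3, ?_⟩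
  intro Ω _ μ _ n σ δ C U θ Z hn hδ hδ1 hindep hZ hC hU
  refine (Arrows.measureReal_goodNoise hn hδ hδ1 hindep hZ).trans
    (MeasureTheory.measureReal_mono fun ω hω => ?_)
  have hlog : 0 < Real.log n := Real.log_pos (by exact_mod_cast hn)
  have hlog8 : 0 < Real.log (8 / δ) := Real.log_pos (by rw [lt_div_iff₀ hδ]; linarith)
  have hC0 : 0 ≤ C := (Finset.sum_nonneg fun _ _ => abs_nonneg _).trans hC
  have hρ : (24 + 8 * Real.log (8 / δ) / Real.log n) * Real.log n =
      24 * Real.log n + 8 * Real.log (8 / δ) := by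
    field_simp
  have hmain := Arrows.sum_sq_predict_sub_le (by omega) σ.2
    (show 0 ≤ (24 + 8 * Real.log (8 / δ) / Real.log n) * Real.log n by positivity) hC hU hω
  refine (Arrows.dynamicRegret_quadLoss n θ _).trans_le (hmain.trans ?_)
  exact Arrows.polylog_bound hn σ.2 hδ hδ1 hC0 hρ
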